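/- Let $\alpha>-\tfrac12$. Let $C_n^{(\alpha)}$ be the Gegenbauer polynomials normalised by $C_n^{(\alpha)}(1)=1$, i.e. $C_0^{(\alpha)}=1$, $C_1^{(\alpha)}(x)=x$, $(n+2\alpha)C_{n+1}^{(\alpha)}(x)=2(n+\alpha)xC_n^{(\alpha)}(x)-nC_{n-1}^{(\alpha)}(x)$ for $n\ge 1$. Put $\lambda_n^{(\alpha)}=\int_{-1}^1 C_n^{(\alpha)}(x)^2(1-x^2)^{\alpha-1/2}\,dx$. For $L>0$ let $C_{L,n}^{(\alpha)}(x)=C_n^{(\alpha)}(2x/L-1)$ and $w_L^{(\alpha)}(x)=(Lx-x^2)^{\alpha-1/2}$ on $[0,L]$, let $x_{L,N,0},\dots,x_{L,N,N}$ be the zeros of $C_{L,N+1}^{(\alpha)}$, and let $$\varpi_{L,N,k}=\Big(\frac L2\Big)^{2\alpha}\Big(\sum_{j=0}^N \big(\lambda_j^{(\alpha)}\big)^{-1}\,C_{L,j}^{(\alpha)}(x_{L,N,k})^2\Big)^{-1}$$ be the corresponding Christoffel numbers. Let $l,\tau>0$, $D=[0,l]\times[0,\tau]$, and let $u\in C^2(D)$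 solve $$u_{tt}+\beta_1u_t+\beta_2u=u_{xx}+f\quad(0<x<l,\ 0<t<\tau),$$ $$u(x,0)=g_1(x),\quad u_t(x,0)=g_2(x)\quad(0<x<l),\qquad u(0,t)=h_1(t),\quad u(l,t)=h_2(t)\quad(0<t\le\tau),$$ where $f$ is integrable on $D$, $\beta_1,\beta_2$ are real constants and $g_1,g_2,h_1,h_2$ are given functions. Put $\phi=u_{xx}$ and, for $0\le n\le N_x$ and $0\le m\le N_t$, $$\tilde\phi_{n,m}=\frac{\displaystyle\sum_{s=0}^{N_x}\sum_{k=0}^{N_t}\varpi_{l,N_x,s}\,\varpi_{\tau,N_t,k}\,\phi(x_{l,N_x,s},x_{\tau,N_t,k})\,C_{l,n}^{(\alpha)}(x_{l,N_x,s})\,C_{\tau,m}^{(\alpha)}(x_{\tau,N_t,k})}{\displaystyle\int_0^l\!\!\int_0^\tau C_{l,n}^{(\alpha)}(x)^2\,C_{\tau,m}^{(\alpha)}(t)^2\,w_l^{(\alpha)}(x)\,w_\tau^{(\alpha)}(t)\,dt\,dx}.$$ Then $|\tilde\phi_{n,m}|\le B_{n,m}\,\|u_{xx}\|_{L^\infty(D)}$,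 where $B_{n,m}$ is given as follows. * If $\alpha\ge0$: $$B_{n,m}=\frac{4(n+\alpha)(m+\alpha)\,\Gamma(n+2\alpha)\,\Gamma(m+2\alpha)}{\Gamma(2\alpha+1)^2\,\Gamma(n+1)\,\Gamma(m+1)},$$ where, for $\alpha=0$, a factor $(k+\alpha)\Gamma(k+2\alpha)$ with $k=0$ is read as its limit $\tfrac12$ as $\alpha\to0^+$. * If $-\frac12<\alpha<0$ and $n,m$ are both even: $$B_{n,m}=\frac{|(n+\alpha)(m+\alpha)|}{\alpha^2}\left|\binom{\frac n2+\alpha-1}{\frac n2}\binom{\frac m2+\alpha-1}{\frac m2}\right|.$$ * If $-\frac12<\alpha<0$ and $n,m$ are both odd: $$B_{n,m}=\frac{4\,|(n+\alpha)(m+\alpha)|\,\Gamma(\frac{n+1}2+\alpha)\,\Gamma(\frac{m+1}2+\alpha)}{\Gamma(\alpha+1)^2\,\Gamma(\frac{n+1}2)\,\Gamma(\frac{m+1}2)\,\sqrt[4]{n^2m^2(n+2\alpha)^2(m+2\alpha)^2}}.$$ * If $-\frac12<\alpha<0$, $n$ is even and $m$ is odd: $$B_{n,m}=\frac{2\,\Gamma(\frac{m+1}2+\alpha)\,|(n+\alpha)(m+\alpha)|}{\alpha^2\,\sqrt{m(m+2\alpha)}\,\Gamma(\frac{m+1}2)\,|\Gamma(\alpha)|}\left|\binom{\frac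 n2+\alpha-1}{\frac n2}\right|.$$ * If $-\frac12<\alpha<0$, $n$ is odd and $m$ is even: the same expression with $n$ and $m$ exchanged. Moreover, put $$D_1^{(\alpha)}=\frac{\pi^2\,2^{3-4\alpha}\,e^{-4\alpha-2}}{\Gamma(\alpha+\frac12)^2\,\Gamma(\alpha+1)^2}.$$ There is a $K$ depending only on $\alpha$ such that, for all $n,m\ge K$, all $N_x\ge n$, $N_t\ge m$, and all $l,\tau,u$ as above, $$|\tilde\phi_{n,m}|\le D_1^{(\alpha)}\,(nm)^{2\alpha}\,\|u_{xx}\|_{L^\infty(D)}\quad\text{if }\alpha\ge0,$$ $$|\tilde\phi_{n,m}|\le D_2^{(\alpha)}\,(nm)^{\alpha}\,\|u_{xx}\|_{L^\infty(D)}\quad\text{if }-\tfrac12<\alpha<0,$$ where $D_2^{(\alpha)}=A_1^{(\alpha)}A_2^{(\alpha)}D_1^{(\alpha)}$ for some constants $A_1^{(\alpha)},A_2^{(\alpha)}>1$ depending only on $\alpha$. -/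

import Mathlib

open MeasureTheory

/-- The Gegenbauer polynomial `C_n^{(α)}` normalised by `C_n^{(α)}(1) = 1`, through its
three-term recurrence
`(n + 2α) C_{n+1} = 2 (n + α) x C_n - n C_{n-1}`, `C_0 = 1`, `C_1 = x`. -/
noncomputable def gegenbauer (α : ℝ) : ℕ → Polynomial ℝ
  | 0 => 1
  | 1 => Polynomial.X
  | n + 2 =>
      Polynomial.C ((((n : ℝ) + 1) + 2 * α)⁻¹) *
        (Polynomial.C (2 * (((n : ℝ) + 1) + α)) * Polynomial.X * gegenbauer α (n + 1)
          - Polynomial.C ((n : ℝ) + 1) * gegenbauer α n)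

/-- The normalisation factor `λ_n = ∫_{-1}^{1} C_n(x)² (1 - x²)^{α - 1/2} dx`. -/
noncomputable def gegenbauerNormSq (α : ℝ) (n : ℕ) : ℝ :=
  ∫ x in (-1 : ℝ)..1, ((gegenbauer α n).eval x) ^ 2 * (1 - x ^ 2) ^ (α - 1 / 2)

/-- The Christoffel number of order `N` attached to a node `x`:
`ϖ⁻¹ = ∑_{j ≤ N} λ_j⁻¹ C_j(x)²`. -/
noncomputable def christoffel (α : ℝ) (N : ℕ) (x : ℝ) : ℝ :=
  (∑ j ∈ Finset.range (N + 1),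
    (gegenbauerNormSq α j)⁻¹ * ((gegenbauer α j).eval x) ^ 2)⁻¹

/-- The shifted Gegenbauer polynomial `C_{L,n}(x) = C_n(2x/L - 1)` on `[0, L]`. -/
noncomputable def shiftedGegenbauer (α L : ℝ) (n : ℕ) : Polynomial ℝ :=
  (gegenbauer α n).comp (Polynomial.C (2 / L) * Polynomial.X - 1)

/-- The weight `w_L(x) = (L x - x²)^{α - 1/2}` on `[0, L]`. -/
noncomputable def shiftedWeight (α L x : ℝ) : ℝ :=
  (L * x - x ^ 2) ^ (α - 1 / 2)

/-- The shifted Gegenbauer-Gauss nodes: the zeros of `C_{L,N+1}`. -/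
noncomputable def shiftedNodes (α L : ℝ) (N : ℕ) : Finset ℝ :=
  (shiftedGegenbauer α L (N + 1)).roots.toFinset

/-- The Christoffel number of a shifted node: `(L/2)^{2α}` times that of the node
`2x/L - 1` of `[-1, 1]`. -/
noncomputable def shiftedChristoffel (α L : ℝ) (N : ℕ) (x : ℝ) : ℝ :=
  (L / 2) ^ (2 * α) * christoffel α N (2 * x / L - 1)

/-- The bivariate shifted Gegenbauer polynomial on `[0, l] × [0, τ]`. -/
noncomputable def bivariateGegenbauer (α l τ : ℝ) (n m : ℕ) (x t : ℝ) : ℝ :=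
  (shiftedGegenbauer α l n).eval x * (shiftedGegenbauer α τ m).eval t

/-- The squared weighted `L²` norm of the bivariate shifted Gegenbauer polynomial. -/
noncomputable def bivariateNormSq (α l τ : ℝ) (n m : ℕ) : ℝ :=
  ∫ x in (0 : ℝ)..l, ∫ t in (0 : ℝ)..τ,
    (bivariateGegenbauer α l τ n m x t) ^ 2 * (shiftedWeight α l x * shiftedWeight α τ t)

/-- The discrete bivariate shifted Gegenbauer coefficient `φ̃_{n,m}` of `φ`, computed from the
values of `φ` on the `(Nx + 1) × (Nt + 1)` grid of shifted Gegenbauer-Gauss nodes. -/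
noncomputable def discreteCoeff (α l τ : ℝ) (Nx Nt : ℕ) (φ : ℝ → ℝ → ℝ) (n m : ℕ) : ℝ :=
  (bivariateNormSq α l τ n m)⁻¹ *
    ∑ x ∈ shiftedNodes α l Nx, ∑ t ∈ shiftedNodes α τ Nt,
      shiftedChristoffel α l Nx x * shiftedChristoffel α τ Nt t * φ x t *
        bivariateGegenbauer α l τ n m x t

/-- The closed rectangle `[0, l] × [0, τ]`. -/
def closedRect (l τ : ℝ) : Set (ℝ × ℝ) :=
  Set.Icc 0 l ×ˢ Set.Icc 0 τ

/-- `u_xx` on `[0, l] × [0, τ]` (one-sided at `x = 0` and `x = l`). -/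
noncomputable def partialXX (l : ℝ) (u : ℝ × ℝ → ℝ) (x t : ℝ) : ℝ :=
  iteratedDerivWithin 2 (fun y => u (y, t)) (Set.Icc 0 l) x

/-- `u_t` on `[0, l] × [0, τ]` (one-sided at `t = 0` and `t = τ`). -/
noncomputable def partialT (τ : ℝ) (u : ℝ × ℝ → ℝ) (x t : ℝ) : ℝ :=
  derivWithin (fun s => u (x, s)) (Set.Icc 0 τ) t

/-- `u_tt` on `[0, l] × [0, τ]` (one-sided at `t = 0` and `t = τ`). -/
noncomputable def partialTT (τ : ℝ) (u : ℝ × ℝ → ℝ) (x t : ℝ) : ℝ :=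
  iteratedDerivWithin 2 (fun s => u (x, s)) (Set.Icc 0 τ) t

/-- The norm of `L^∞([0, l] × [0, τ])` (essential supremum for Lebesgue measure). -/
noncomputable def linftyNorm (l τ : ℝ) (φ : ℝ → ℝ → ℝ) : ℝ :=
  (eLpNorm (fun p : ℝ × ℝ => φ p.1 p.2) ⊤ (volume.restrict (closedRect l τ))).toReal

/-- `u` is a solution, of class `C²` on the closed rectangle `[0, l] × [0, τ]`, of the telegraph
equation `u_tt + β₁ u_t + β₂ u = u_xx + f` with initial data `g₁, g₂` and Dirichlet boundary
data `h₁, h₂`. -/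
structure IsTelegraphSolution (l τ β₁ β₂ : ℝ) (f : ℝ × ℝ → ℝ) (g₁ g₂ h₁ h₂ : ℝ → ℝ)
    (u : ℝ × ℝ → ℝ) : Prop where
  contDiffOn : ContDiffOn ℝ 2 u (closedRect l τ)
  integrableOn_source : IntegrableOn f (closedRect l τ)
  equation : ∀ x ∈ Set.Ioo 0 l, ∀ t ∈ Set.Ioo 0 τ,
    partialTT τ u x t + β₁ * partialT τ u x t + β₂ * u (x, t) = partialXX l u x t + f (x, t)
  initial_value : ∀ x ∈ Set.Ioo 0 l, u (x, 0) = g₁ x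
  initial_velocity : ∀ x ∈ Set.Ioo 0 l, partialT τ u x 0 = g₂ x
  boundary_left : ∀ t ∈ Set.Ioc 0 τ, u (0, t) = h₁ t
  boundary_right : ∀ t ∈ Set.Ioc 0 τ, u (l, t) = h₂ t

/-- The factor `(n + α) Γ(n + 2α)`, read as its limit `1/2` (as `α → 0⁺`) at `n = α = 0`, where
the expression itself is undefined. -/
noncomputable def gammaFactor (α : ℝ) (n : ℕ) : ℝ :=
  if α = 0 ∧ n = 0 then 1 / 2 else (n + α) * Real.Gamma (n + 2 * α)

/-- The constant `D₁^{(α)} = π² 2^{3 - 4α} e^{-4α - 2} / (Γ(α + 1/2)² Γ(α + 1)²)`. -/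
noncomputable def asymptoticConst (α : ℝ) : ℝ :=
  Real.pi ^ 2 * (2 : ℝ) ^ (3 - 4 * α) * Real.exp (-4 * α - 2) /
    (Real.Gamma (α + 1 / 2) ^ 2 * Real.Gamma (α + 1) ^ 2)

/-! Everything reduces to one variable. The Christoffel numbers are positive, the grid is a product
and the nodes are interior, so the discrete coefficient is at most M_n M_m times the supremum of
|u_xx| over the open rectangle, with M_n = λ_n⁻¹ ∑ ϖ |C_n| over the nodes (`abs_discreteCoeff_le`).
Since u is C², u_xx is continuous and this supremum is controlled by the essential supremum
(`abs_le_linftyNorm`).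

For M_n, the vectors √ϖ_x (λ_j^{-1/2} C_j(x))_{j ≤ N}, x a node, are orthonormal by
Christoffel-Darboux. Bessel's inequality then gives ∑ ϖ C_n² ≤ λ_n for n ≤ N
(`sum_christoffel_mul_sq_le`), and ∑ ϖ ≤ λ_0 when n = 0; exactness of Gauss quadrature is not
needed. Two estimates follow.

The explicit bounds use M_n ≤ (λ_0/λ_n) max |C_n|. The Sonin function n(n+2α) C_n² + (1-x²) C_n'² is
monotone on [0,1] in the direction given by the sign of α, so it bounds |C_n| by its value at 1 (α ≥
0) or by data at 0 (α < 0); both combine with λ_0/λ_n into closed forms.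

The asymptotic bounds use Cauchy-Schwarz: M_n ≤ √(λ_0/λ_n) = O(n^α), since λ_0/λ_n = O(n^{2α}) by
Euler's limit for Γ. For α > 0 the spare factor (nm)^α absorbs the constant, for α = 0 the constants
are compared numerically, and for α < 0 the constants A₁, A₂ absorb it. -/

/-! ### Recurrence, structure relations and differential equation -/

open Polynomial in
theorem gegenbauer_recurrence (α : ℝ) (hα : -(1 / 2) < α) (n : ℕ) :
    C ((n : ℝ) + 1 + 2 * α) * gegenbauer α (n + 2) =
      C (2 * ((n : ℝ) + 1 + α)) * X * gegenbauer α (n + 1) - C ((n : ℝ) + 1) * gegenbauer α n := by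
  have h : (n : ℝ) + 1 + 2 * α ≠ 0 := by
    have : (0 : ℝ) ≤ n := n.cast_nonneg
    linarith
  rw [gegenbauer, ← mul_assoc, ← C_mul, mul_inv_cancel₀ h, C_1, one_mul]

theorem gegenbauer_eval_recurrence (α : ℝ) (hα : -(1 / 2) < α) (n : ℕ) (x : ℝ) :
    ((n : ℝ) + 1 + 2 * α) * (gegenbauer α (n + 2)).eval x =
      2 * ((n : ℝ) + 1 + α) * x * (gegenbauer α (n + 1)).eval x
        - ((n : ℝ) + 1) * (gegenbauer α n).eval x := by
  simpa using congrArg (Polynomial.eval x) (gegenbauer_recurrence α hα n)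

theorem gegenbauer_derivative_recurrence (α : ℝ) (hα : -(1 / 2) < α) (n : ℕ) (x : ℝ) :
    ((n : ℝ) + 1 + 2 * α) * (gegenbauer α (n + 2)).derivative.eval x =
      2 * ((n : ℝ) + 1 + α) *
        ((gegenbauer α (n + 1)).eval x + x * (gegenbauer α (n + 1)).derivative.eval x)
        - ((n : ℝ) + 1) * (gegenbauer α n).derivative.eval x := by
  have := congrArg (fun p => Polynomial.eval x (Polynomial.derivative p))
    (gegenbauer_recurrence α hα n)
  simp only [Polynomial.derivative_mul, Polynomial.derivative_C, Polynomial.derivative_sub,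
    Polynomial.derivative_X, Polynomial.eval_add, Polynomial.eval_mul, Polynomial.eval_sub,
    Polynomial.eval_C, Polynomial.eval_X, Polynomial.eval_zero, Polynomial.eval_one] at this
  linear_combination this

@[simp] theorem gegenbauer_zero (α : ℝ) : gegenbauer α 0 = 1 := by rw [gegenbauer]

@[simp] theorem gegenbauer_one (α : ℝ) : gegenbauer α 1 = Polynomial.X := by rw [gegenbauer]

theorem cast_add_one_add_two_mul_pos {α : ℝ} (hα : -(1 / 2) < α) (n : ℕ) :
    0 < (n : ℝ) + 1 + 2 * α := by
  have : (0 : ℝ) ≤ n := n.cast_nonneg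
  linarith

theorem cast_add_one_add_pos {α : ℝ} (hα : -(1 / 2) < α) (n : ℕ) : 0 < (n : ℝ) + 1 + α := by
  have : (0 : ℝ) ≤ n := n.cast_nonneg
  linarith

/-- Both structure relations for the derivative. -/
theorem gegenbauer_derivative_structure (α : ℝ) (hα : -(1 / 2) < α) (n : ℕ) (x : ℝ) :
    (1 - x ^ 2) * (gegenbauer α n).derivative.eval x =
        (n + 2 * α) * (x * (gegenbauer α n).eval x - (gegenbauer α (n + 1)).eval x) ∧
      (1 - x ^ 2) * (gegenbauer α (n + 1)).derivative.eval x =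
        (n + 1) * ((gegenbauer α n).eval x - x * (gegenbauer α (n + 1)).eval x) := by
  induction n with
  | zero => simp; ring
  | succ n ih =>
    obtain ⟨hB, hA⟩ := ih
    have hr := gegenbauer_eval_recurrence α hα n x
    have hd := gegenbauer_derivative_recurrence α hα n x
    have hp := (cast_add_one_add_two_mul_pos hα n).ne'
    push_cast
    -- The two relations feed each other: the first is the previous second one plus the recurrence;
    -- the second comes from the differentiated recurrence times 1 - x², with both previous
    -- relations eliminating the derivatives.
    constructor
    · linear_combination hA + hr
    · apply mul_left_cancel₀ hp
      linear_combination (1 - x ^ 2) * hd + 2 * ((n : ℝ) + 1 + α) * x * hA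
        - ((n : ℝ) + 1) * hB + ((n : ℝ) + 2) * x * hr

/-- The Gegenbauer differential equation on `(-1, 1)`. -/
theorem gegenbauer_ode (α : ℝ) (hα : -(1 / 2) < α) (n : ℕ) (x : ℝ) (hx : 1 - x ^ 2 ≠ 0) :
    (1 - x ^ 2) * (gegenbauer α n).derivative.derivative.eval x
        - (2 * α + 1) * x * (gegenbauer α n).derivative.eval x
        + n * (n + 2 * α) * (gegenbauer α n).eval x = 0 := by
  cases n with
  | zero => simp
  | succ n =>
    -- Differentiating the second structure relation brings in C_n', which the first one removes at
    -- the price of a factor 1 - x²; hence the restriction on x.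
    have hpoly : (1 - Polynomial.X ^ 2) * (gegenbauer α (n + 1)).derivative =
        Polynomial.C ((n : ℝ) + 1) *
          (gegenbauer α n - Polynomial.X * gegenbauer α (n + 1)) := by
      refine Polynomial.funext fun y => ?_
      simpa using (gegenbauer_derivative_structure α hα n y).2
    have h := congrArg (fun p => Polynomial.eval x (Polynomial.derivative p)) hpoly
    simp only [Polynomial.derivative_mul, Polynomial.derivative_C, Polynomial.derivative_sub,
      Polynomial.derivative_X, Polynomial.eval_add, Polynomial.eval_mul, Polynomial.eval_sub,
      Polynomial.eval_C, Polynomial.eval_X, Polynomial.eval_zero, Polynomial.eval_one,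
      Polynomial.derivative_one, Polynomial.derivative_X_pow, Polynomial.eval_pow] at h
    norm_num at h
    obtain ⟨hB, hA⟩ := gegenbauer_derivative_structure α hα n x
    apply mul_left_cancel₀ hx
    push_cast
    linear_combination (1 - x ^ 2) * h + ((n : ℝ) + 1) * hB
      + (2 - 2 * α - ((n : ℝ) + 2)) * x * hA

/-! ### Parity, value at 1 and location of the zeros -/

/-- Consecutive degrees are carried together, here and below, so that the three-term recurrence
closes the induction. -/
theorem gegenbauer_eval_neg (α : ℝ) (hα : -(1 / 2) < α) (n : ℕ) (x : ℝ) :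
    (gegenbauer α n).eval (-x) = (-1) ^ n * (gegenbauer α n).eval x ∧
      (gegenbauer α (n + 1)).eval (-x) = (-1) ^ (n + 1) * (gegenbauer α (n + 1)).eval x := by
  induction n with
  | zero => simp
  | succ n ih =>
    refine ⟨ih.2, mul_left_cancel₀ (cast_add_one_add_two_mul_pos hα n).ne' ?_⟩
    have h1 := gegenbauer_eval_recurrence α hα n x
    have h2 := gegenbauer_eval_recurrence α hα n (-x)
    rw [ih.1, ih.2] at h2
    rw [h2]
    linear_combination (-1) ^ (n + 2) * (-h1)

theorem gegenbauer_eval_one (α : ℝ) (hα : -(1 / 2) < α) (n : ℕ) :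
    (gegenbauer α n).eval 1 = 1 ∧ (gegenbauer α (n + 1)).eval 1 = 1 := by
  induction n with
  | zero => simp
  | succ n ih =>
    refine ⟨ih.2, mul_left_cancel₀ (cast_add_one_add_two_mul_pos hα n).ne' ?_⟩
    rw [gegenbauer_eval_recurrence α hα n 1, ih.1, ih.2]
    ring

/-- By the recurrence, C_{n+2} - C_{n+1} is a positive combination of (x - 1) C_{n+1} and C_{n+1} -
C_n. This excludes zeros in [1, ∞), and by parity in (-∞, -1]. -/
theorem gegenbauer_eval_pos (α : ℝ) (hα : -(1 / 2) < α) (n : ℕ) {x : ℝ} (hx : 1 ≤ x) :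
    0 < (gegenbauer α n).eval x ∧
      (gegenbauer α n).eval x ≤ (gegenbauer α (n + 1)).eval x := by
  induction n with
  | zero => simpa
  | succ n ih =>
    obtain ⟨h0, h1⟩ := ih
    have hpos := h0.trans_le h1
    refine ⟨hpos, le_of_mul_le_mul_left ?_ (cast_add_one_add_two_mul_pos hα n)⟩
    rw [gegenbauer_eval_recurrence α hα n x]
    have h2 : 0 ≤ ((n : ℝ) + 1 + α) * (gegenbauer α (n + 1)).eval x * (x - 1) :=
      mul_nonneg (mul_pos (cast_add_one_add_pos hα n) hpos).le (by linarith)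
    have h3 : 0 ≤ ((n : ℝ) + 1) * ((gegenbauer α (n + 1)).eval x - (gegenbauer α n).eval x) :=
      mul_nonneg (by positivity) (by linarith)
    linarith

theorem gegenbauer_root_mem_Ioo (α : ℝ) (hα : -(1 / 2) < α) (n : ℕ) {x : ℝ}
    (hx : (gegenbauer α n).eval x = 0) : x ∈ Set.Ioo (-1 : ℝ) 1 := by
  constructor
  · by_contra! h
    have h1 := (gegenbauer_eval_pos α hα n (x := -x) (by linarith)).1
    rw [(gegenbauer_eval_neg α hα n x).1, hx] at h1
    simp at h1
  · by_contra! h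
    exact (gegenbauer_eval_pos α hα n h).1.ne' hx

/-! ### Sonin's function and pointwise bounds -/

/-- The Sonin function `n (n + 2α) C_n² + (1 - x²) C_n'²`. -/
noncomputable def soninFun (α : ℝ) (n : ℕ) (x : ℝ) : ℝ :=
  n * (n + 2 * α) * (gegenbauer α n).eval x ^ 2
    + (1 - x ^ 2) * (gegenbauer α n).derivative.eval x ^ 2

/-- The differential equation cancels both C_n C_n' and C_n' C_n'', leaving a term whose sign on (0,
1) is that of α. -/
theorem hasDerivAt_soninFun (α : ℝ) (hα : -(1 / 2) < α) (n : ℕ) (x : ℝ) (hx : 1 - x ^ 2 ≠ 0) :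
    HasDerivAt (soninFun α n) (4 * α * x * (gegenbauer α n).derivative.eval x ^ 2) x := by
  have h1 := (((gegenbauer α n).hasDerivAt x).pow 2).const_mul ((n : ℝ) * (n + 2 * α))
  have h2 := (((hasDerivAt_id x).pow 2).const_sub 1).mul
    (((gegenbauer α n).derivative.hasDerivAt x).pow 2)
  refine (h1.add h2).congr_deriv ?_
  have := gegenbauer_ode α hα n x hx
  simp only [Pi.pow_apply, id]
  norm_num
  linear_combination 2 * (gegenbauer α n).derivative.eval x * this

theorem continuous_soninFun (α : ℝ) (n : ℕ) : Continuous (soninFun α n) := by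
  unfold soninFun
  fun_prop

theorem one_sub_sq_pos_of_mem_Ioo {x : ℝ} (hx : x ∈ Set.Ioo (-1 : ℝ) 1) : 0 < 1 - x ^ 2 := by
  nlinarith [hx.1, hx.2]

theorem soninFun_monotoneOn (α : ℝ) (hα : 0 ≤ α) (n : ℕ) :
    MonotoneOn (soninFun α n) (Set.Icc 0 1) := by
  refine monotoneOn_of_hasDerivWithinAt_nonneg (convex_Icc 0 1)
    (continuous_soninFun α n).continuousOn (fun x hx => ?_) (fun x hx => ?_) (f' := fun x =>
      4 * α * x * (gegenbauer α n).derivative.eval x ^ 2)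
  · rw [interior_Icc] at hx
    exact (hasDerivAt_soninFun α (by linarith) n x
      (one_sub_sq_pos_of_mem_Ioo ⟨by linarith [hx.1], hx.2⟩).ne').hasDerivWithinAt
  · rw [interior_Icc] at hx
    have := hx.1.le
    positivity

theorem soninFun_antitoneOn (α : ℝ) (hα : -(1 / 2) < α) (h0 : α ≤ 0) (n : ℕ) :
    AntitoneOn (soninFun α n) (Set.Icc 0 1) := by
  refine antitoneOn_of_hasDerivWithinAt_nonpos (convex_Icc 0 1)
    (continuous_soninFun α n).continuousOn (fun x hx => ?_) (fun x hx => ?_) (f' := fun x =>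
      4 * α * x * (gegenbauer α n).derivative.eval x ^ 2)
  · rw [interior_Icc] at hx
    exact (hasDerivAt_soninFun α hα n x
      (one_sub_sq_pos_of_mem_Ioo ⟨by linarith [hx.1], hx.2⟩).ne').hasDerivWithinAt
  · rw [interior_Icc] at hx
    have h1 : 0 ≤ x * (gegenbauer α n).derivative.eval x ^ 2 :=
      mul_nonneg hx.1.le (sq_nonneg _)
    nlinarith

theorem gegenbauer_eval_abs_sq (α : ℝ) (hα : -(1 / 2) < α) (n : ℕ) (x : ℝ) :
    (gegenbauer α n).eval |x| ^ 2 = (gegenbauer α n).eval x ^ 2 := by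
  rcases abs_choice x with h | h
  · rw [h]
  · rw [h, (gegenbauer_eval_neg α hα n x).1, mul_pow, ← pow_mul, mul_comm n 2, pow_mul]
    simp

/-- Comparison of the increasing Sonin function with its value at 1, where the factor 1 - x² kills
the derivative term. -/
theorem abs_gegenbauer_eval_le_one (α : ℝ) (hα : 0 ≤ α) (n : ℕ) {x : ℝ}
    (hx : x ∈ Set.Ioo (-1 : ℝ) 1) : |(gegenbauer α n).eval x| ≤ 1 := by
  rcases Nat.eq_zero_or_pos n with rfl | hn
  · simp
  have hα' : -(1 / 2) < α := by linarith
  have hx1 : |x| ≤ 1 := abs_le.2 ⟨hx.1.le, hx.2.le⟩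
  have hm := soninFun_monotoneOn α hα n ⟨abs_nonneg x, hx1⟩ ⟨zero_le_one, le_rfl⟩ hx1
  simp only [soninFun, gegenbauer_eval_abs_sq α hα', (gegenbauer_eval_one α hα' n).1, sq_abs]
    at hm
  have hN : 0 < (n : ℝ) * (n + 2 * α) := by positivity
  have h2 : 0 ≤ (1 - x ^ 2) * (gegenbauer α n).derivative.eval |x| ^ 2 :=
    mul_nonneg (one_sub_sq_pos_of_mem_Ioo hx).le (sq_nonneg _)
  refine abs_le_of_sq_le_sq' ?_ zero_le_one |> abs_le.2
  refine le_of_mul_le_mul_left ?_ hN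
  linarith

/-- Comparison of the decreasing Sonin function with its value at 0. By parity only one of the two
terms on the right survives: the first for even n, the second for odd n. -/
theorem gegenbauer_eval_sq_le (α : ℝ) (hα : -(1 / 2) < α) (h0 : α ≤ 0) (n : ℕ) {x : ℝ}
    (hx : x ∈ Set.Ioo (-1 : ℝ) 1) :
    n * (n + 2 * α) * (gegenbauer α n).eval x ^ 2 ≤
      n * (n + 2 * α) * (gegenbauer α n).eval 0 ^ 2
        + (gegenbauer α n).derivative.eval 0 ^ 2 := by
  have hx1 : |x| ≤ 1 := abs_le.2 ⟨hx.1.le, hx.2.le⟩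
  have hm := soninFun_antitoneOn α hα h0 n ⟨le_rfl, zero_le_one⟩ ⟨abs_nonneg x, hx1⟩
    (abs_nonneg x)
  simp only [soninFun, gegenbauer_eval_abs_sq α hα, sq_abs] at hm
  have h2 : 0 ≤ (1 - x ^ 2) * (gegenbauer α n).derivative.eval |x| ^ 2 :=
    mul_nonneg (one_sub_sq_pos_of_mem_Ioo hx).le (sq_nonneg _)
  linarith

theorem gegenbauer_eval_zero_of_odd (α : ℝ) (hα : -(1 / 2) < α) {n : ℕ} (hn : Odd n) :
    (gegenbauer α n).eval 0 = 0 := by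
  have := (gegenbauer_eval_neg α hα n 0).1
  rw [hn.neg_one_pow, neg_zero] at this
  linarith

theorem gegenbauer_derivative_eval_zero (α : ℝ) (hα : -(1 / 2) < α) (n : ℕ) :
    (gegenbauer α (n + 1)).derivative.eval 0 = (n + 1) * (gegenbauer α n).eval 0 := by
  simpa using (gegenbauer_derivative_structure α hα n 0).2

/-- For `α < 0` and even degree, the maximum of `|C_n|` is attained at `0`. -/
theorem abs_gegenbauer_eval_le_of_even (α : ℝ) (hα : -(1 / 2) < α) (h0 : α ≤ 0) {n : ℕ}
    (hn : Even n) {x : ℝ} (hx : x ∈ Set.Ioo (-1 : ℝ) 1) :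
    |(gegenbauer α n).eval x| ≤ |(gegenbauer α n).eval 0| := by
  cases n with
  | zero => simp
  | succ n =>
    have h := gegenbauer_eval_sq_le α hα h0 (n + 1) hx
    have hodd : Odd n := by
      rw [Nat.even_add_one, Nat.not_even_iff_odd] at hn
      exact hn
    rw [gegenbauer_derivative_eval_zero α hα, gegenbauer_eval_zero_of_odd α hα hodd] at h
    push_cast at h
    have hN : 0 < ((n : ℝ) + 1) * (n + 1 + 2 * α) :=
      mul_pos (by positivity) (cast_add_one_add_two_mul_pos hα n)
    exact sq_le_sq.1 (le_of_mul_le_mul_left (by linarith) hN)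

/-- For `α < 0` and odd degree, `|C_n|` is at most `|C_n'(0)| / √(n (n + 2α))`. -/
theorem abs_gegenbauer_eval_le_of_odd (α : ℝ) (hα : -(1 / 2) < α) (h0 : α ≤ 0) {n : ℕ}
    (hn : Odd (n + 1)) {x : ℝ} (hx : x ∈ Set.Ioo (-1 : ℝ) 1) :
    |(gegenbauer α (n + 1)).eval x| ≤
      (n + 1) * |(gegenbauer α n).eval 0| / Real.sqrt ((n + 1) * (n + 1 + 2 * α)) := by
  have h := gegenbauer_eval_sq_le α hα h0 (n + 1) hx
  rw [gegenbauer_derivative_eval_zero α hα, gegenbauer_eval_zero_of_odd α hα hn] at h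
  push_cast at h
  have hN : 0 < ((n : ℝ) + 1) * (n + 1 + 2 * α) :=
    mul_pos (by positivity) (cast_add_one_add_two_mul_pos hα n)
  refine abs_le_of_sq_le_sq ?_ (by positivity)
  rw [div_pow, Real.sq_sqrt hN.le, le_div_iff₀ hN, mul_pow _ |_|, sq_abs]
  linarith

/-! ### Orthogonality and norms -/

theorem intervalIntegrable_one_sub_sq_rpow (α : ℝ) (hα : -(1 / 2) < α) :
    IntervalIntegrable (fun x : ℝ => (1 - x ^ 2) ^ (α - 1 / 2)) volume (-1) 1 := by
  have hright : IntervalIntegrable (fun x : ℝ => (1 - x ^ 2) ^ (α - 1 / 2)) volume 0 1 := by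
    have h1 : IntervalIntegrable (fun x : ℝ => (1 - x) ^ (α - 1 / 2)) volume 0 1 := by
      have h := (intervalIntegral.intervalIntegrable_rpow' (a := 0) (b := 1)
        (r := α - 1 / 2) (by linarith)).comp_sub_left 1
      simpa using h.symm
    have h2 : ContinuousOn (fun x : ℝ => (1 + x) ^ (α - 1 / 2)) (Set.uIcc 0 1) := by
      refine ContinuousOn.rpow_const (by fun_prop) fun x hx => Or.inl ?_
      rw [Set.uIcc_of_le zero_le_one] at hx
      linarith [hx.1]
    refine (h1.mul_continuousOn h2).congr fun x hx => ?_
    rw [Set.uIoc_of_le zero_le_one] at hx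
    rw [← Real.mul_rpow (by linarith [hx.2]) (by linarith [hx.1])]
    ring_nf
  have hleft : IntervalIntegrable (fun x : ℝ => (1 - x ^ 2) ^ (α - 1 / 2)) volume (-1) 0 := by
    have h := hright.comp_sub_left 0
    simp only [zero_sub, neg_sq, sub_zero] at h
    simpa using h.symm
  exact hleft.trans hright

/-- The integral of a polynomial against the Gegenbauer weight. -/
noncomputable def gegenbauerIntegral (α : ℝ) (p : Polynomial ℝ) : ℝ :=
  ∫ x in (-1 : ℝ)..1, p.eval x * (1 - x ^ 2) ^ (α - 1 / 2)

theorem intervalIntegrable_polynomial_mul_weight (α : ℝ) (hα : -(1 / 2) < α)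
    (p : Polynomial ℝ) :
    IntervalIntegrable (fun x : ℝ => p.eval x * (1 - x ^ 2) ^ (α - 1 / 2)) volume (-1) 1 :=
  (intervalIntegrable_one_sub_sq_rpow α hα).continuousOn_mul p.continuous.continuousOn

theorem gegenbauerIntegral_sub (α : ℝ) (hα : -(1 / 2) < α) (p q : Polynomial ℝ) :
    gegenbauerIntegral α (p - q) = gegenbauerIntegral α p - gegenbauerIntegral α q := by
  unfold gegenbauerIntegral
  rw [← intervalIntegral.integral_sub (intervalIntegrable_polynomial_mul_weight α hα p)
    (intervalIntegrable_polynomial_mul_weight α hα q)]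
  simp [sub_mul]

theorem gegenbauerIntegral_C_mul (α c : ℝ) (p : Polynomial ℝ) :
    gegenbauerIntegral α (Polynomial.C c * p) = c * gegenbauerIntegral α p := by
  unfold gegenbauerIntegral
  rw [← intervalIntegral.integral_const_mul]
  simp [mul_assoc]

theorem gegenbauerNormSq_eq (α : ℝ) (n : ℕ) :
    gegenbauerNormSq α n = gegenbauerIntegral α (gegenbauer α n * gegenbauer α n) := by
  simp [gegenbauerNormSq, gegenbauerIntegral, sq]

theorem gegenbauerNormSq_zero_pos (α : ℝ) (hα : -(1 / 2) < α) : 0 < gegenbauerNormSq α 0 := by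
  rw [gegenbauerNormSq_eq]
  refine intervalIntegral.intervalIntegral_pos_of_pos_on
    (intervalIntegrable_polynomial_mul_weight α hα _) (fun x hx => ?_) (by norm_num)
  simpa using Real.rpow_pos_of_pos (one_sub_sq_pos_of_mem_Ioo hx) _

/-- Sturm-Liouville argument: (1 - x²)^{α+1/2} (p'q - pq') has derivative (m(m+2α) - n(n+2α)) p q
times the weight, and vanishes at ±1 because α + 1/2 > 0. The eigenvalue difference factors as (m -
n)(m + n + 2α). -/
theorem gegenbauer_orthogonal (α : ℝ) (hα : -(1 / 2) < α) {n m : ℕ} (hnm : n ≠ m) :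
    gegenbauerIntegral α (gegenbauer α n * gegenbauer α m) = 0 := by
  set p := gegenbauer α n with hp
  set q := gegenbauer α m with hq
  have key : gegenbauerIntegral α
      (Polynomial.C ((m : ℝ) * (m + 2 * α) - n * (n + 2 * α)) * (p * q)) =
      ((1 : ℝ) - 1 ^ 2) ^ (α + 1 / 2) *
          (p.derivative.eval 1 * q.eval 1 - p.eval 1 * q.derivative.eval 1)
        - (1 - (-1) ^ 2) ^ (α + 1 / 2) *
          (p.derivative.eval (-1) * q.eval (-1) - p.eval (-1) * q.derivative.eval (-1)) := by
    refine intervalIntegral.integral_eq_sub_of_hasDerivAt_of_le (f := fun x : ℝ =>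
      (1 - x ^ 2) ^ (α + 1 / 2) *
        (p.derivative.eval x * q.eval x - p.eval x * q.derivative.eval x)) (by norm_num)
      ?_ (fun x hx => ?_) (intervalIntegrable_polynomial_mul_weight α hα _)
    · refine ContinuousOn.mul (ContinuousOn.rpow_const (by fun_prop)
        fun x _ => Or.inr (by linarith)) (by fun_prop)
    · have hx0 := one_sub_sq_pos_of_mem_Ioo hx
      have h1 : HasDerivAt (fun x : ℝ => 1 - x ^ 2) (-(2 * x)) x := by
        simpa using ((hasDerivAt_id x).pow 2).const_sub 1
      have h2 := h1.rpow_const (p := α + 1 / 2) (Or.inl hx0.ne')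
      have h3 := ((p.derivative.hasDerivAt x).mul (q.hasDerivAt x)).sub
        ((p.hasDerivAt x).mul (q.derivative.hasDerivAt x))
      refine (h2.mul h3).congr_deriv ?_
      have ep := gegenbauer_ode α hα n x hx0.ne'
      have eq := gegenbauer_ode α hα m x hx0.ne'
      rw [← hp] at ep
      rw [← hq] at eq
      have hw : (1 - x ^ 2) ^ (α + 1 / 2) = (1 - x ^ 2) ^ (α - 1 / 2) * (1 - x ^ 2) := by
        rw [← Real.rpow_add_one hx0.ne']
        ring_nf
      rw [hw, show α + 1 / 2 - 1 = α - 1 / 2 by ring]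
      simp only [Polynomial.eval_mul, Polynomial.eval_C, Pi.sub_apply, Pi.mul_apply]
      linear_combination (1 - x ^ 2) ^ (α - 1 / 2) * (q.eval x * ep - p.eval x * eq)
  rw [gegenbauerIntegral_C_mul] at key
  have h0 : (0 : ℝ) ^ (α + 1 / 2) = 0 := Real.zero_rpow (by linarith)
  norm_num at key
  norm_num at h0
  rw [h0] at key
  simp only [zero_mul, sub_zero, mul_eq_zero] at key
  refine key.resolve_left fun h => ?_
  have h2 : ((m : ℝ) - n) * (m + n + 2 * α) = 0 := by linear_combination h
  rcases mul_eq_zero.1 h2 with h3 | h3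
  · exact hnm (by exact_mod_cast (sub_eq_zero.1 h3).symm)
  · have : m + n = 0 := by
      by_contra h4
      have : (1 : ℝ) ≤ m + n := by exact_mod_cast Nat.one_le_iff_ne_zero.2 h4
      linarith
    omega

/-- The recurrence tested against C_k, where C_{k+2} drops out. Tested against C_{k+2} instead, it
yields the recurrence of the norms below. -/
theorem gegenbauerIntegral_X_mul (α : ℝ) (hα : -(1 / 2) < α) (k : ℕ) :
    2 * ((k : ℝ) + 1 + α) *
        gegenbauerIntegral α (Polynomial.X * gegenbauer α k * gegenbauer α (k + 1)) =
      (k + 1) * gegenbauerNormSq α k := by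
  have h := congrArg (fun p => gegenbauerIntegral α (p * gegenbauer α k))
    (gegenbauer_recurrence α hα k)
  simp only [sub_mul, gegenbauerIntegral_sub α hα, mul_assoc, gegenbauerIntegral_C_mul] at h
  rw [gegenbauer_orthogonal α hα (by omega)] at h
  rw [gegenbauerNormSq_eq, mul_assoc Polynomial.X, mul_comm (gegenbauer α k) (gegenbauer α (k+1))]
  linarith

theorem gegenbauerNormSq_one (α : ℝ) (hα : -(1 / 2) < α) :
    2 * (1 + α) * gegenbauerNormSq α 1 = gegenbauerNormSq α 0 := by
  have h := gegenbauerIntegral_X_mul α hα 0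
  rw [gegenbauerNormSq_eq α 1]
  simpa using h

theorem gegenbauerNormSq_succ_succ (α : ℝ) (hα : -(1 / 2) < α) (n : ℕ) :
    ((n : ℝ) + 2 + α) * (n + 1 + 2 * α) * gegenbauerNormSq α (n + 2) =
      (n + 1 + α) * (n + 2) * gegenbauerNormSq α (n + 1) := by
  have h := congrArg (fun p => gegenbauerIntegral α (p * gegenbauer α (n + 2)))
    (gegenbauer_recurrence α hα n)
  simp only [sub_mul, gegenbauerIntegral_sub α hα, mul_assoc, gegenbauerIntegral_C_mul] at h
  rw [← gegenbauerNormSq_eq, gegenbauer_orthogonal α hα (n := n) (by omega)] at h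
  have h2 := gegenbauerIntegral_X_mul α hα (n + 1)
  push_cast at h2
  rw [mul_assoc Polynomial.X] at h2
  linear_combination ((n : ℝ) + 2 + α) * h + ((n : ℝ) + 1 + α) * h2

theorem gegenbauerNormSq_pos (α : ℝ) (hα : -(1 / 2) < α) (n : ℕ) : 0 < gegenbauerNormSq α n := by
  cases n with
  | zero => exact gegenbauerNormSq_zero_pos α hα
  | succ n =>
    induction n with
    | zero =>
      have h := gegenbauerNormSq_one α hα
      have h0 := gegenbauerNormSq_zero_pos α hα
      rw [← h] at h0
      exact pos_of_mul_pos_right h0 (by linarith)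
    | succ n ih =>
      have h := gegenbauerNormSq_succ_succ α hα n
      have h1 := cast_add_one_add_pos hα n
      have h2 := cast_add_one_add_two_mul_pos hα n
      have h3 : 0 < ((n : ℝ) + 2 + α) * (n + 1 + 2 * α) := mul_pos (by linarith) h2
      refine pos_of_mul_pos_right (b := gegenbauerNormSq α (n + 2)) ?_ h3.le
      rw [h]
      positivity

/-! ### Christoffel numbers and discrete Bessel inequality -/

/-- The Christoffel-Darboux formula. -/
theorem gegenbauer_christoffel_darboux (α : ℝ) (hα : -(1 / 2) < α) (N : ℕ) (x y : ℝ) :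
    (x - y) * ∑ j ∈ Finset.range (N + 1), (gegenbauerNormSq α j)⁻¹ *
        ((gegenbauer α j).eval x * (gegenbauer α j).eval y) =
      (N + 1) / (2 * (N + 1 + α) * gegenbauerNormSq α (N + 1)) *
        ((gegenbauer α (N + 1)).eval x * (gegenbauer α N).eval y
          - (gegenbauer α N).eval x * (gegenbauer α (N + 1)).eval y) := by
  induction N with
  | zero =>
    have h := gegenbauerNormSq_one α hα
    simp only [zero_add, Finset.sum_range_one, gegenbauer_zero, gegenbauer_one, ← h,
      Polynomial.eval_one, Polynomial.eval_X, Nat.cast_zero, one_div]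
    ring
  | succ N ih =>
    rw [Finset.sum_range_succ, mul_add, ih]
    have h1 := gegenbauer_eval_recurrence α hα N x
    have h2 := gegenbauer_eval_recurrence α hα N y
    have h3 := gegenbauerNormSq_succ_succ α hα N
    have p1 := (gegenbauerNormSq_pos α hα (N + 1)).ne'
    have p2 := (gegenbauerNormSq_pos α hα (N + 2)).ne'
    have q1 := (cast_add_one_add_pos hα N).ne'
    have q2 := (cast_add_one_add_pos hα (N + 1)).ne'
    have q3 := (cast_add_one_add_two_mul_pos hα N).ne'
    push_cast at q2 ⊢
    -- The norm recurrence matches the leading coefficients of two consecutive degrees, so the sum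
    -- telescopes.
    have e : ((N : ℝ) + 1 + 1) / (2 * (N + 1 + 1 + α) * gegenbauerNormSq α (N + 1 + 1)) =
        (N + 1 + 2 * α) / (2 * (N + 1 + α) * gegenbauerNormSq α (N + 1)) := by
      rw [div_eq_div_iff (by positivity) (by positivity)]
      linear_combination (-2) * h3
    rw [e]
    field_simp
    linear_combination (gegenbauer α (N + 1)).eval x * h2 - (gegenbauer α (N + 1)).eval y * h1

theorem gegenbauer_kernel_eq_zero (α : ℝ) (hα : -(1 / 2) < α) (N : ℕ) {x y : ℝ} (hxy : x ≠ y)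
    (hx : (gegenbauer α (N + 1)).eval x = 0) (hy : (gegenbauer α (N + 1)).eval y = 0) :
    ∑ j ∈ Finset.range (N + 1), (gegenbauerNormSq α j)⁻¹ *
        ((gegenbauer α j).eval x * (gegenbauer α j).eval y) = 0 := by
  have h := gegenbauer_christoffel_darboux α hα N x y
  rw [hx, hy] at h
  simp only [zero_mul, mul_zero, sub_zero, mul_eq_zero] at h
  exact h.resolve_left (sub_ne_zero.2 hxy)

theorem christoffel_pos (α : ℝ) (hα : -(1 / 2) < α) (N : ℕ) (x : ℝ) : 0 < christoffel α N x := by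
  refine inv_pos.2 (Finset.sum_pos' (fun j _ => ?_) ⟨0, by simp, ?_⟩)
  · have := gegenbauerNormSq_pos α hα j
    positivity
  · simpa using gegenbauerNormSq_pos α hα 0

/-- Bessel's inequality for the kernel vectors at the Gauss nodes. -/
theorem sum_christoffel_mul_sq_le (α : ℝ) (hα : -(1 / 2) < α) {n N : ℕ} (hn : n ≤ N)
    (X : Finset ℝ) (hX : ∀ x ∈ X, (gegenbauer α (N + 1)).eval x = 0) :
    ∑ x ∈ X, christoffel α N x * (gegenbauer α n).eval x ^ 2 ≤ gegenbauerNormSq α n := by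
  have hs (j : ℕ) : Real.sqrt (gegenbauerNormSq α j)⁻¹ ^ 2 = (gegenbauerNormSq α j)⁻¹ :=
    Real.sq_sqrt (inv_nonneg.2 (gegenbauerNormSq_pos α hα j).le)
  let v : X → EuclideanSpace ℝ (Fin (N + 1)) := fun x => WithLp.toLp 2 fun j =>
    Real.sqrt (christoffel α N x) *
      (Real.sqrt (gegenbauerNormSq α j)⁻¹ * (gegenbauer α j).eval (x : ℝ))
  have hinner (x y : X) : inner ℝ (v x) (v y) =
      Real.sqrt (christoffel α N x) * Real.sqrt (christoffel α N y) *
        ∑ j ∈ Finset.range (N + 1), (gegenbauerNormSq α j)⁻¹ *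
          ((gegenbauer α j).eval (x : ℝ) * (gegenbauer α j).eval (y : ℝ)) := by
    rw [Finset.sum_range, Finset.mul_sum, PiLp.inner_apply]
    refine Finset.sum_congr rfl fun j _ => ?_
    simp only [v, RCLike.inner_apply, conj_trivial]
    linear_combination Real.sqrt (christoffel α N x) * Real.sqrt (christoffel α N y) *
      (gegenbauer α j).eval (x : ℝ) * (gegenbauer α j).eval (y : ℝ) * hs j
  -- Unit length is the definition of the Christoffel number; orthogonality is the vanishing of the
  -- kernel at two distinct zeros of C_{N+1}.
  have hv : Orthonormal ℝ v := by
    rw [orthonormal_iff_ite]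
    intro x y
    rw [hinner]
    split_ifs with h
    · subst h
      have hp := christoffel_pos α hα N x
      rw [Real.mul_self_sqrt hp.le]
      have : christoffel α N x * (christoffel α N x)⁻¹ = 1 := mul_inv_cancel₀ hp.ne'
      rw [christoffel, inv_inv] at this
      simpa only [christoffel, sq] using this
    · rw [gegenbauer_kernel_eq_zero α hα N (fun h' => h (Subtype.ext h')) (hX x x.2) (hX y y.2),
        mul_zero]
  -- Bessel for the n-th basis vector, which exists because n ≤ N, reads ∑ ϖ λ_n⁻¹ C_n² ≤ 1.
  have hb := hv.sum_inner_products_le (s := Finset.univ)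
    (EuclideanSpace.single (⟨n, by omega⟩ : Fin (N + 1)) (1 : ℝ))
  have hl := gegenbauerNormSq_pos α hα n
  simp only [EuclideanSpace.inner_single_right, PiLp.norm_single, norm_one, one_pow, v,
    Real.norm_eq_abs, sq_abs, conj_trivial, one_mul, mul_pow, hs,
    Real.sq_sqrt (christoffel_pos α hα N _).le] at hb
  rw [Finset.sum_coe_sort X (fun x : ℝ => christoffel α N x *
    ((gegenbauerNormSq α n)⁻¹ * (gegenbauer α n).eval x ^ 2))] at hb
  calc ∑ x ∈ X, christoffel α N x * (gegenbauer α n).eval x ^ 2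
      = gegenbauerNormSq α n * ∑ x ∈ X, christoffel α N x *
          ((gegenbauerNormSq α n)⁻¹ * (gegenbauer α n).eval x ^ 2) := by
        rw [Finset.mul_sum]
        refine Finset.sum_congr rfl fun x _ => ?_
        field_simp
    _ ≤ gegenbauerNormSq α n * 1 := by gcongr
    _ = gegenbauerNormSq α n := mul_one _

theorem sum_christoffel_le (α : ℝ) (hα : -(1 / 2) < α) (N : ℕ)
    (X : Finset ℝ) (hX : ∀ x ∈ X, (gegenbauer α (N + 1)).eval x = 0) :
    ∑ x ∈ X, christoffel α N x ≤ gegenbauerNormSq α 0 := by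
  simpa using sum_christoffel_mul_sq_le α hα N.zero_le X hX

theorem sum_christoffel_mul_abs_le_of_le (α : ℝ) (hα : -(1 / 2) < α) (n N : ℕ)
    (X : Finset ℝ) (hX : ∀ x ∈ X, (gegenbauer α (N + 1)).eval x = 0) {M : ℝ}
    (hM : ∀ x ∈ Set.Ioo (-1 : ℝ) 1, |(gegenbauer α n).eval x| ≤ M) :
    ∑ x ∈ X, christoffel α N x * |(gegenbauer α n).eval x| ≤ gegenbauerNormSq α 0 * M := by
  have hM0 : 0 ≤ M := (abs_nonneg _).trans (hM 0 (by norm_num))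
  calc ∑ x ∈ X, christoffel α N x * |(gegenbauer α n).eval x|
      ≤ ∑ x ∈ X, christoffel α N x * M := Finset.sum_le_sum fun x hx =>
        mul_le_mul_of_nonneg_left (hM x (gegenbauer_root_mem_Ioo α hα (N + 1) (hX x hx)))
          (christoffel_pos α hα N x).le
    _ ≤ gegenbauerNormSq α 0 * M := by
      rw [← Finset.sum_mul]
      exact mul_le_mul_of_nonneg_right (sum_christoffel_le α hα N X hX) hM0

/-- Cauchy-Schwarz with weights ϖ; Bessel bounds both resulting sums. -/
theorem sum_christoffel_mul_abs_le_sqrt (α : ℝ) (hα : -(1 / 2) < α) {n N : ℕ} (hn : n ≤ N)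
    (X : Finset ℝ) (hX : ∀ x ∈ X, (gegenbauer α (N + 1)).eval x = 0) :
    ∑ x ∈ X, christoffel α N x * |(gegenbauer α n).eval x| ≤
      Real.sqrt (gegenbauerNormSq α 0 * gegenbauerNormSq α n) := by
  refine Real.le_sqrt_of_sq_le ?_
  have hc (x : ℝ) := (christoffel_pos α hα N x).le
  calc (∑ x ∈ X, christoffel α N x * |(gegenbauer α n).eval x|) ^ 2
      = (∑ x ∈ X, Real.sqrt (christoffel α N x) *
          (Real.sqrt (christoffel α N x) * |(gegenbauer α n).eval x|)) ^ 2 := by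
        congr 1
        refine Finset.sum_congr rfl fun x _ => ?_
        rw [← mul_assoc, Real.mul_self_sqrt (hc x)]
    _ ≤ (∑ x ∈ X, Real.sqrt (christoffel α N x) ^ 2) *
          ∑ x ∈ X, (Real.sqrt (christoffel α N x) * |(gegenbauer α n).eval x|) ^ 2 :=
        Finset.sum_mul_sq_le_sq_mul_sq _ _ _
    _ = (∑ x ∈ X, christoffel α N x) *
          ∑ x ∈ X, christoffel α N x * (gegenbauer α n).eval x ^ 2 := by
        simp only [mul_pow, sq_abs, Real.sq_sqrt (hc _)]
    _ ≤ gegenbauerNormSq α 0 * gegenbauerNormSq α n :=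
        mul_le_mul (sum_christoffel_le α hα N X hX) (sum_christoffel_mul_sq_le α hα hn X hX)
          (Finset.sum_nonneg fun x _ => mul_nonneg (hc x) (sq_nonneg _))
          (gegenbauerNormSq_pos α hα 0).le

/-! ### Transfer to [0, L] and separation of variables -/

theorem shiftedGegenbauer_eval (α L : ℝ) (n : ℕ) (x : ℝ) :
    (shiftedGegenbauer α L n).eval x = (gegenbauer α n).eval (2 * x / L - 1) := by
  simp only [shiftedGegenbauer, Polynomial.eval_comp, Polynomial.eval_sub, Polynomial.eval_mul,
    Polynomial.eval_C, Polynomial.eval_X, Polynomial.eval_one]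
  ring_nf

theorem shiftedNodes_eval {α L : ℝ} {N : ℕ} {x : ℝ} (hx : x ∈ shiftedNodes α L N) :
    (gegenbauer α (N + 1)).eval (2 * x / L - 1) = 0 := by
  rw [shiftedNodes, Multiset.mem_toFinset] at hx
  rw [← shiftedGegenbauer_eval]
  exact (Polynomial.mem_roots'.1 hx).2

theorem shiftedNodes_mem_Ioo {α L : ℝ} (hα : -(1 / 2) < α) (hL : 0 < L) {N : ℕ} {x : ℝ}
    (hx : x ∈ shiftedNodes α L N) : x ∈ Set.Ioo 0 L := by
  obtain ⟨h1, h2⟩ := gegenbauer_root_mem_Ioo α hα _ (shiftedNodes_eval hx)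
  have e : x = L / 2 * (2 * x / L) := by field_simp
  constructor
  · rw [e]
    exact mul_pos (by linarith) (by linarith)
  · rw [e]
    nlinarith

/-- The shifted nodes mapped back to `[-1, 1]`. -/
noncomputable def standardNodes (α L : ℝ) (N : ℕ) : Finset ℝ :=
  (shiftedNodes α L N).image fun x => 2 * x / L - 1

theorem standardNodes_eval {α L : ℝ} {N : ℕ} : ∀ x ∈ standardNodes α L N,
    (gegenbauer α (N + 1)).eval x = 0 := by
  intro x hx
  obtain ⟨y, hy, rfl⟩ := Finset.mem_image.1 hx
  exact shiftedNodes_eval hy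

theorem sum_standardNodes {α L : ℝ} (hL : 0 < L) (N : ℕ) (g : ℝ → ℝ) :
    ∑ x ∈ standardNodes α L N, g x = ∑ x ∈ shiftedNodes α L N, g (2 * x / L - 1) := by
  refine Finset.sum_image fun x _ y _ h => ?_
  field_simp at h
  linarith

/-- The normalised discrete absolute moment `λ_n⁻¹ ∑ ϖ |C_n|` over the nodes. -/
noncomputable def absMoment (α L : ℝ) (N n : ℕ) : ℝ :=
  (gegenbauerNormSq α n)⁻¹ *
    ∑ x ∈ standardNodes α L N, christoffel α N x * |(gegenbauer α n).eval x|

theorem absMoment_nonneg (α L : ℝ) (hα : -(1 / 2) < α) (N n : ℕ) : 0 ≤ absMoment α L N n :=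
  mul_nonneg (inv_nonneg.2 (gegenbauerNormSq_pos α hα n).le)
    (Finset.sum_nonneg fun x _ => mul_nonneg (christoffel_pos α hα N x).le (abs_nonneg _))

theorem absMoment_le_of_le (α L : ℝ) (hα : -(1 / 2) < α) (N n : ℕ) {M : ℝ}
    (hM : ∀ x ∈ Set.Ioo (-1 : ℝ) 1, |(gegenbauer α n).eval x| ≤ M) :
    absMoment α L N n ≤ gegenbauerNormSq α 0 / gegenbauerNormSq α n * M := by
  have h := sum_christoffel_mul_abs_le_of_le α hα n N (standardNodes α L N) standardNodes_eval hM
  have hl := gegenbauerNormSq_pos α hα n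
  calc absMoment α L N n ≤ (gegenbauerNormSq α n)⁻¹ * (gegenbauerNormSq α 0 * M) :=
        mul_le_mul_of_nonneg_left h (inv_nonneg.2 hl.le)
    _ = _ := by ring

theorem absMoment_le_sqrt (α L : ℝ) (hα : -(1 / 2) < α) {n N : ℕ} (hn : n ≤ N) :
    absMoment α L N n ≤ Real.sqrt (gegenbauerNormSq α 0 / gegenbauerNormSq α n) := by
  have h := sum_christoffel_mul_abs_le_sqrt α hα hn (standardNodes α L N) standardNodes_eval
  have hl := gegenbauerNormSq_pos α hα n
  have h0 := gegenbauerNormSq_pos α hα 0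
  calc absMoment α L N n
      ≤ (gegenbauerNormSq α n)⁻¹ *
          Real.sqrt (gegenbauerNormSq α 0 * gegenbauerNormSq α n) :=
        mul_le_mul_of_nonneg_left h (inv_nonneg.2 hl.le)
    _ = Real.sqrt (gegenbauerNormSq α 0 / gegenbauerNormSq α n) := by
        rw [Real.sqrt_mul h0.le, Real.sqrt_div h0.le, div_eq_mul_inv, mul_left_comm]
        congr 1
        rw [inv_mul_eq_div, Real.sqrt_div_self]

/-- With y = 2x/L - 1 one has Lx - x² = (L/2)² (1 - y²): the weight contributes (L/2)^{2α-1} and dx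
one more L/2. -/
theorem integral_shiftedGegenbauer_sq (α : ℝ) {L : ℝ} (hL : 0 < L) (n : ℕ) :
    ∫ x in (0 : ℝ)..L, (shiftedGegenbauer α L n).eval x ^ 2 * shiftedWeight α L x =
      (L / 2) ^ (2 * α) * gegenbauerNormSq α n := by
  have hL2 : 0 < L / 2 := by linarith
  have h1 : ∀ x ∈ Set.uIcc 0 L,
      (shiftedGegenbauer α L n).eval x ^ 2 * shiftedWeight α L x =
      (fun y : ℝ => (L / 2) ^ (2 * α - 1) *
        ((gegenbauer α n).eval y ^ 2 * (1 - y ^ 2) ^ (α - 1 / 2))) (x / (L / 2) - 1) := by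
    intro x hx
    rw [Set.uIcc_of_le hL.le] at hx
    have e : L * x - x ^ 2 = (L / 2) ^ 2 * (1 - (x / (L / 2) - 1) ^ 2) := by
      field_simp
      ring
    have hnn : 0 ≤ 1 - (x / (L / 2) - 1) ^ 2 := by
      refine nonneg_of_mul_nonneg_right ?_ (pow_pos hL2 2)
      rw [← e]
      nlinarith [mul_nonneg hx.1 (sub_nonneg.2 hx.2)]
    rw [shiftedGegenbauer_eval, shiftedWeight, e, Real.mul_rpow (by positivity) hnn,
      ← Real.rpow_natCast, ← Real.rpow_natCast (L / 2) 2, ← Real.rpow_mul hL2.le]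
    norm_num
    rw [show 2 * (α - 1 / 2) = 2 * α - 1 by ring, show 2 * x / L = x / (L / 2) by field_simp]
    ring
  rw [intervalIntegral.integral_congr h1, intervalIntegral.integral_comp_div_sub (fun y : ℝ => (L / 2) ^ (2 * α - 1) *
        ((gegenbauer α n).eval y ^ 2 * (1 - y ^ 2) ^ (α - 1 / 2))) hL2.ne',
    intervalIntegral.integral_const_mul, zero_div, show L / (L / 2) - 1 = 1 by field_simp; norm_num,
    zero_sub, gegenbauerNormSq, smul_eq_mul, ← mul_assoc]
  congr 1
  rw [mul_comm, ← Real.rpow_add_one hL2.ne']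
  ring_nf

theorem bivariateNormSq_eq (α : ℝ) {l τ : ℝ} (hl : 0 < l) (hτ : 0 < τ) (n m : ℕ) :
    bivariateNormSq α l τ n m = (l / 2) ^ (2 * α) * gegenbauerNormSq α n *
      ((τ / 2) ^ (2 * α) * gegenbauerNormSq α m) := by
  rw [← integral_shiftedGegenbauer_sq α hl, ← integral_shiftedGegenbauer_sq α hτ,
    bivariateNormSq, ← intervalIntegral.integral_mul_const]
  refine intervalIntegral.integral_congr fun x _ => ?_
  rw [← intervalIntegral.integral_const_mul]
  refine intervalIntegral.integral_congr fun t _ => ?_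
  simp only [bivariateGegenbauer]
  ring

/-- The powers of l/2 and τ/2 in the Christoffel numbers cancel those in the norm, and the double
sum factors. -/
theorem abs_discreteCoeff_le (α : ℝ) (hα : -(1 / 2) < α) {l τ : ℝ} (hl : 0 < l) (hτ : 0 < τ)
    (Nx Nt : ℕ) {φ : ℝ → ℝ → ℝ} {B : ℝ}
    (hφ : ∀ x ∈ Set.Ioo 0 l, ∀ t ∈ Set.Ioo 0 τ, |φ x t| ≤ B) (n m : ℕ) :
    |discreteCoeff α l τ Nx Nt φ n m| ≤ absMoment α l Nx n * absMoment α τ Nt m * B := by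
  have hn := gegenbauerNormSq_pos α hα n
  have hm := gegenbauerNormSq_pos α hα m
  have pl : 0 < (l / 2) ^ (2 * α) := Real.rpow_pos_of_pos (by linarith) _
  have pτ : 0 < (τ / 2) ^ (2 * α) := Real.rpow_pos_of_pos (by linarith) _
  rw [discreteCoeff, bivariateNormSq_eq α hl hτ, abs_mul, abs_of_nonneg (by positivity)]
  calc _ ≤ ((l / 2) ^ (2 * α) * gegenbauerNormSq α n *
        ((τ / 2) ^ (2 * α) * gegenbauerNormSq α m))⁻¹ *
        ∑ x ∈ shiftedNodes α l Nx, ∑ t ∈ shiftedNodes α τ Nt,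
          ((l / 2) ^ (2 * α) * (τ / 2) ^ (2 * α) * B) *
          ((christoffel α Nx (2 * x / l - 1) * |(gegenbauer α n).eval (2 * x / l - 1)|) *
          (christoffel α Nt (2 * t / τ - 1) * |(gegenbauer α m).eval (2 * t / τ - 1)|)) := by
        refine mul_le_mul_of_nonneg_left ?_ (by positivity)
        refine (Finset.abs_sum_le_sum_abs _ _).trans (Finset.sum_le_sum fun x hx => ?_)
        refine (Finset.abs_sum_le_sum_abs _ _).trans (Finset.sum_le_sum fun t ht => ?_)
        have hB := hφ x (shiftedNodes_mem_Ioo hα hl hx) t (shiftedNodes_mem_Ioo hα hτ ht)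
        have c1 := christoffel_pos α hα Nx (2 * x / l - 1)
        have c2 := christoffel_pos α hα Nt (2 * t / τ - 1)
        rw [bivariateGegenbauer, shiftedGegenbauer_eval, shiftedGegenbauer_eval,
          shiftedChristoffel, shiftedChristoffel, abs_mul, abs_mul,
          abs_mul (Polynomial.eval _ _), abs_of_nonneg (a := _ * _ * (_ * _)) (by positivity)]
        calc _ = ((l / 2) ^ (2 * α) * (τ / 2) ^ (2 * α) * |φ x t|) *
          ((christoffel α Nx (2 * x / l - 1) * |(gegenbauer α n).eval (2 * x / l - 1)|) *
          (christoffel α Nt (2 * t / τ - 1) * |(gegenbauer α m).eval (2 * t / τ - 1)|)) := by ring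
          _ ≤ _ := by gcongr
    _ = absMoment α l Nx n * absMoment α τ Nt m * B := by
        simp only [absMoment, sum_standardNodes hl, sum_standardNodes hτ]
        simp only [← Finset.mul_sum, ← Finset.sum_mul]
        field_simp

/-! ### Values of u_xx at interior points -/

/-- The slice derivatives agree with the derivative within the rectangle applied to (1, 0), taken
twice; the latter is continuous for a C² function. -/
theorem continuousOn_partialXX {l τ : ℝ} (hl : 0 < l) (hτ : 0 < τ) {u : ℝ × ℝ → ℝ}
    (hu : ContDiffOn ℝ 2 u (closedRect l τ)) :
    ContinuousOn (fun p : ℝ × ℝ => partialXX l u p.1 p.2) (closedRect l τ) := by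
  have hD : UniqueDiffOn ℝ (closedRect l τ) := (uniqueDiffOn_Icc hl).prod (uniqueDiffOn_Icc hτ)
  have slice {g : ℝ × ℝ → ℝ} (hg : DifferentiableOn ℝ g (closedRect l τ)) {x t : ℝ}
      (hx : x ∈ Set.Icc 0 l) (ht : t ∈ Set.Icc 0 τ) :
      derivWithin (fun y => g (y, t)) (Set.Icc 0 l) x =
        fderivWithin ℝ g (closedRect l τ) (x, t) (1, 0) := by
    have h1 : HasDerivWithinAt (fun y : ℝ => (y, t)) ((1 : ℝ), (0 : ℝ)) (Set.Icc 0 l) x :=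
      (hasDerivWithinAt_id x _).prodMk (hasDerivWithinAt_const x _ t)
    have h2 := (hg (x, t) ⟨hx, ht⟩).hasFDerivWithinAt
    have h3 : Set.MapsTo (fun y : ℝ => (y, t)) (Set.Icc 0 l) (closedRect l τ) :=
      fun y hy => ⟨hy, ht⟩
    exact (h2.comp_hasDerivWithinAt x h1 h3).derivWithin
      (uniqueDiffOn_Icc hl x hx)
  have h1 : ContDiffOn ℝ 1 (fun p => fderivWithin ℝ u (closedRect l τ) p (1, 0))
      (closedRect l τ) :=
    (hu.fderivWithin hD (m := 1) (by norm_num)).clm_apply contDiffOn_const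
  have h2 : ContDiffOn ℝ 0 (fun p => fderivWithin ℝ
      (fun p => fderivWithin ℝ u (closedRect l τ) p (1, 0)) (closedRect l τ) p (1, 0))
      (closedRect l τ) :=
    (h1.fderivWithin hD (m := 0) (by norm_num)).clm_apply contDiffOn_const
  refine h2.continuousOn.congr fun ⟨x, t⟩ ⟨hx, ht⟩ => ?_
  simp only at hx ht ⊢
  rw [← slice (h1.differentiableOn one_ne_zero) hx ht, partialXX]
  rw [iteratedDerivWithin_succ, iteratedDerivWithin_one]
  refine derivWithin_congr (fun y hy => ?_) ?_
  · exact slice (hu.differentiableOn two_ne_zero) hy ht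
  · exact slice (hu.differentiableOn two_ne_zero) hx ht

theorem abs_le_linftyNorm {l τ : ℝ} {φ : ℝ → ℝ → ℝ}
    (hφ : ContinuousOn (fun p : ℝ × ℝ => φ p.1 p.2) (closedRect l τ)) {x t : ℝ}
    (hx : x ∈ Set.Ioo 0 l) (ht : t ∈ Set.Ioo 0 τ) : |φ x t| ≤ linftyNorm l τ φ := by
  have hcompact : IsCompact (closedRect l τ) := isCompact_Icc.prod isCompact_Icc
  have hmeas : MeasurableSet (closedRect l τ) := measurableSet_Icc.prod measurableSet_Icc
  obtain ⟨M, hM⟩ := hcompact.exists_bound_of_continuousOn hφ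
  -- Finiteness matters: `toReal` would send an infinite norm to 0.
  have hfin : eLpNorm (fun p : ℝ × ℝ => φ p.1 p.2) ⊤ (volume.restrict (closedRect l τ)) ≠ ⊤ := by
    have := eLpNormEssSup_le_of_ae_bound (μ := volume.restrict (closedRect l τ))
      ((ae_restrict_iff' hmeas).2 (Filter.Eventually.of_forall hM))
    rw [eLpNorm_exponent_top]
    exact (this.trans_lt ENNReal.ofReal_lt_top).ne
  by_contra! hlt
  have hopen : IsOpen (Set.Ioo 0 l ×ˢ Set.Ioo 0 τ) := isOpen_Ioo.prod isOpen_Ioo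
  have hsub : Set.Ioo 0 l ×ˢ Set.Ioo 0 τ ⊆ closedRect l τ :=
    Set.prod_mono Set.Ioo_subset_Icc_self Set.Ioo_subset_Icc_self
  -- A violation at one interior point would persist on a nonempty open set, which has positive
  -- measure.
  have hU : IsOpen ((Set.Ioo 0 l ×ˢ Set.Ioo 0 τ) ∩
      (fun p : ℝ × ℝ => |φ p.1 p.2|) ⁻¹' Set.Ioi (linftyNorm l τ φ)) :=
    (hφ.mono hsub).abs.isOpen_inter_preimage hopen isOpen_Ioi
  have hpos := hU.measure_pos volume ⟨(x, t), ⟨hx, ht⟩, hlt⟩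
  refine hpos.ne' ?_
  have hae := ae_le_eLpNormEssSup (f := fun p : ℝ × ℝ => φ p.1 p.2)
    (μ := volume.restrict (closedRect l τ))
  rw [ae_restrict_iff' hmeas, ae_iff] at hae
  refine measure_mono_null (fun p hp => ?_) hae
  intro h
  have h3 := h (hsub hp.1)
  refine absurd hp.2 (not_lt (α := ℝ).2 ?_)
  rw [← eLpNorm_exponent_top] at h3
  have h4 := ENNReal.toReal_mono hfin h3
  simpa [linftyNorm] using h4

/-! ### Closed forms for the norm ratio -/

/-- The ratio `λ_0 / λ_n`. -/
noncomputable def normSqRatio (α : ℝ) (n : ℕ) : ℝ := gegenbauerNormSq α 0 / gegenbauerNormSq α n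

theorem normSqRatio_pos (α : ℝ) (hα : -(1 / 2) < α) (n : ℕ) : 0 < normSqRatio α n :=
  div_pos (gegenbauerNormSq_pos α hα 0) (gegenbauerNormSq_pos α hα n)

theorem normSqRatio_zero (α : ℝ) (hα : -(1 / 2) < α) : normSqRatio α 0 = 1 :=
  div_self (gegenbauerNormSq_pos α hα 0).ne'

theorem normSqRatio_one (α : ℝ) (hα : -(1 / 2) < α) : normSqRatio α 1 = 2 * (1 + α) := by
  have h1 := (gegenbauerNormSq_pos α hα 1).ne'
  rw [normSqRatio, ← gegenbauerNormSq_one α hα]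
  field_simp

theorem normSqRatio_succ (α : ℝ) (hα : -(1 / 2) < α) (n : ℕ) :
    ((n : ℝ) + α) * (n + 1) * normSqRatio α (n + 1) =
      (n + 1 + α) * (n + 2 * α) * normSqRatio α n := by
  cases n with
  | zero =>
    rw [normSqRatio_zero α hα, normSqRatio_one α hα]
    push_cast
    ring
  | succ n =>
    have h := gegenbauerNormSq_succ_succ α hα n
    have h1 := (gegenbauerNormSq_pos α hα (n + 1)).ne'
    have h2 := (gegenbauerNormSq_pos α hα (n + 2)).ne'
    simp only [normSqRatio]
    field_simp
    push_cast
    linear_combination (-gegenbauerNormSq α 0) * h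

/-- Starting at degree 1 keeps the argument of Γ positive, also for α ≤ 0. -/
theorem normSqRatio_mul_Gamma (α : ℝ) (hα : -(1 / 2) < α) (n : ℕ) :
    normSqRatio α (n + 1) * (Real.Gamma (2 * α + 1) * (n + 1).factorial) =
      2 * (n + 1 + α) * Real.Gamma (n + 1 + 2 * α) := by
  induction n with
  | zero =>
    rw [zero_add, normSqRatio_one α hα]
    simp only [Nat.factorial_one, Nat.cast_zero, zero_add, Nat.cast_one]
    rw [add_comm 1 (2 * α)]
    ring
  | succ n ih =>
    have hp := cast_add_one_add_two_mul_pos hα n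
    have hG := Real.Gamma_add_one hp.ne'
    have h := normSqRatio_succ α hα (n + 1)
    have h1 := (cast_add_one_add_pos hα n).ne'
    push_cast at h ⊢
    rw [show (n : ℝ) + 1 + 1 + 2 * α = n + 1 + 2 * α + 1 by ring, hG]
    rw [Nat.factorial_succ]
    apply mul_left_cancel₀ h1
    push_cast
    linear_combination Real.Gamma (2 * α + 1) * (n + 1).factorial * h
      + ((n : ℝ) + 1 + 1 + α) * (n + 1 + 2 * α) * ih

theorem normSqRatio_eq_gammaFactor (α : ℝ) (hα : 0 ≤ α) (n : ℕ) :
    normSqRatio α n =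
      2 * gammaFactor α n / (Real.Gamma (2 * α + 1) * Real.Gamma (n + 1)) := by
  have hα' : -(1 / 2) < α := by linarith
  have hG : 0 < Real.Gamma (2 * α + 1) := Real.Gamma_pos_of_pos (by linarith)
  cases n with
  | zero =>
    rw [normSqRatio_zero α hα', gammaFactor]
    split_ifs with h
    · rw [h.1]
      simp
    · have h0 : α ≠ 0 := fun h' => h ⟨h', rfl⟩
      have := Real.Gamma_add_one (mul_ne_zero two_ne_zero h0)
      rw [eq_div_iff (by simpa using hG.ne')]
      simp only [Nat.cast_zero, zero_add, Real.Gamma_one, this]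
      ring
  | succ n =>
    have h := normSqRatio_mul_Gamma α hα' n
    have hf : (0 : ℝ) < (n + 1).factorial := by positivity
    rw [gammaFactor, if_neg (by simp), Real.Gamma_nat_eq_factorial, eq_div_iff (by positivity), h]
    push_cast
    ring

theorem multichoose_succ_mul (r : ℝ) (k : ℕ) :
    ((k : ℝ) + 1) * Ring.multichoose r (k + 1) = (r + k) * Ring.multichoose r k := by
  have h1 := Ring.factorial_nsmul_multichoose_eq_ascPochhammer r k
  have h2 := Ring.factorial_nsmul_multichoose_eq_ascPochhammer r (k + 1)
  rw [Polynomial.ascPochhammer_smeval_eq_eval, nsmul_eq_mul] at h1 h2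
  rw [ascPochhammer_succ_eval, ← h1, Nat.factorial_succ] at h2
  have hf : ((k.factorial : ℕ) : ℝ) ≠ 0 := by positivity
  apply mul_left_cancel₀ hf
  push_cast at h2
  linear_combination h2

theorem gegenbauer_eval_zero_succ_succ (α : ℝ) (hα : -(1 / 2) < α) (n : ℕ) :
    ((n : ℝ) + 1 + 2 * α) * (gegenbauer α (n + 2)).eval 0 =
      -((n : ℝ) + 1) * (gegenbauer α n).eval 0 := by
  rw [gegenbauer_eval_recurrence α hα n 0]
  ring

theorem two_mul_cast_add_ne_zero {α : ℝ} (hα : -(1 / 2) < α) (h0 : α ≠ 0) (k : ℕ) :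
    2 * (k : ℝ) + α ≠ 0 := by
  rcases k.eq_zero_or_pos with rfl | hk
  · simpa
  · have : (1 : ℝ) ≤ k := by exact_mod_cast hk
    linarith

/-- From k to k + 1 both sides are multiplied by -(2k+2+α)(k+α) / ((2k+α)(k+1)): the factor 2k+1+2α
gained by the norm ratio is lost by the value at 0. -/
theorem normSqRatio_mul_eval_zero (α : ℝ) (hα : -(1 / 2) < α) (h0 : α ≠ 0) (k : ℕ) :
    α * (normSqRatio α (2 * k) * (gegenbauer α (2 * k)).eval 0) =
      (-1) ^ k * ((2 * k + α) * Ring.multichoose α k) := by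
  induction k with
  | zero => simp [normSqRatio_zero α hα]
  | succ k ih =>
    have h1 := normSqRatio_succ α hα (2 * k)
    have h2 := normSqRatio_succ α hα (2 * k + 1)
    have h3 := gegenbauer_eval_zero_succ_succ α hα (2 * k)
    have h4 := multichoose_succ_mul α k
    have p1 := two_mul_cast_add_ne_zero hα h0 k
    have p2 := (cast_add_one_add_pos hα (2 * k)).ne'
    have p3 := (cast_add_one_add_two_mul_pos hα (2 * k)).ne'
    have p4 : (k : ℝ) + 1 ≠ 0 := by positivity
    have p5 : 2 * (k : ℝ) + 1 ≠ 0 := by positivity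
    push_cast at h1 h2 h3 p2 p3 ⊢
    rw [show 2 * (k + 1) = 2 * k + 1 + 1 by ring]
    have e1 : normSqRatio α (2 * k + 1) = (2 * k + 1 + α) * (2 * k + 2 * α) *
        normSqRatio α (2 * k) / ((2 * k + α) * (2 * k + 1)) := by
      rw [eq_div_iff (by positivity)]
      linear_combination h1
    have e2 : normSqRatio α (2 * k + 1 + 1) = (2 * k + 1 + 1 + α) * (2 * k + 1 + 2 * α) *
        normSqRatio α (2 * k + 1) / ((2 * k + 1 + α) * (2 * k + 1 + 1)) := by
      rw [eq_div_iff (mul_ne_zero p2 (by positivity))]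
      linear_combination h2
    have e3 : (gegenbauer α (2 * k + 1 + 1)).eval 0 =
        -(2 * k + 1) * (gegenbauer α (2 * k)).eval 0 / (2 * k + 1 + 2 * α) := by
      rw [eq_div_iff p3]
      linear_combination h3
    have e4 : Ring.multichoose α (k + 1) = (α + k) * Ring.multichoose α k / (k + 1) := by
      rw [eq_div_iff p4]
      linear_combination h4
    have e5 : normSqRatio α (2 * k) * (gegenbauer α (2 * k)).eval 0 =
        (-1) ^ k * ((2 * k + α) * Ring.multichoose α k) / α := by
      rw [eq_div_iff h0]
      linear_combination ih
    obtain ⟨d, hd⟩ : ∃ d, 2 * (k : ℝ) + 1 + 2 * α = d := ⟨_, rfl⟩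
    rw [hd] at e2 e3 p3
    calc _ = -((2 * k + 2 + α) * (k + α) / ((2 * k + α) * (k + 1))) * α *
          (normSqRatio α (2 * k) * (gegenbauer α (2 * k)).eval 0) := by
          rw [e2, e1, e3]
          field_simp
          ring
      _ = _ := by
          rw [e5, e4]
          field_simp
          ring

/-- A form of Γ(k+α) = Γ(α) k! `multichoose α k` cleared of Γ at nonpositive arguments; it turns the
binomial into the Γ quotient of the odd case. -/
theorem mul_Gamma_eq_multichoose (α : ℝ) (hα : -(1 / 2) < α) (k : ℕ) :
    α * Real.Gamma (k + 1 + α) =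
      (k + α) * (Ring.multichoose α k * (Real.Gamma (α + 1) * k.factorial)) := by
  induction k with
  | zero => simp [add_comm]
  | succ k ih =>
    have h := multichoose_succ_mul α k
    have hG := Real.Gamma_add_one (cast_add_one_add_pos hα k).ne'
    push_cast
    rw [show (k : ℝ) + 1 + 1 + α = k + 1 + α + 1 by ring, hG, Nat.factorial_succ]
    push_cast
    linear_combination ((k : ℝ) + 1 + α) * ih
      - ((k : ℝ) + 1 + α) * (Real.Gamma (α + 1) * k.factorial) * h

/-- One step of the ratio recurrence from the even case; (2k+1) C_{2k}(0) is C_{2k+1}'(0). -/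
theorem normSqRatio_mul_eval_zero_of_odd (α : ℝ) (hα : -(1 / 2) < α) (h0 : α ≠ 0) (k : ℕ) :
    normSqRatio α (2 * k + 1) * ((2 * k + 1) * (gegenbauer α (2 * k)).eval 0) =
      (-1) ^ k * (2 * (2 * k + 1 + α) *
        (Real.Gamma (k + 1 + α) / (Real.Gamma (α + 1) * k.factorial))) := by
  have h1 := normSqRatio_succ α hα (2 * k)
  have h2 := normSqRatio_mul_eval_zero α hα h0 k
  have h3 := mul_Gamma_eq_multichoose α hα k
  have p1 := two_mul_cast_add_ne_zero hα h0 k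
  have hG : 0 < Real.Gamma (α + 1) := Real.Gamma_pos_of_pos (by linarith)
  push_cast at h1
  have e : Real.Gamma (k + 1 + α) / (Real.Gamma (α + 1) * k.factorial) =
      (k + α) * Ring.multichoose α k / α := by
    rw [div_eq_div_iff (by positivity) h0]
    linear_combination h3
  have hq : (k + α) * Ring.multichoose α k / α * α = (k + α) * Ring.multichoose α k :=
    div_mul_cancel₀ _ h0
  rw [e]
  apply mul_left_cancel₀ (mul_ne_zero p1 h0)
  linear_combination α * (gegenbauer α (2 * k)).eval 0 * h1
    + 2 * (2 * (k : ℝ) + 1 + α) * (k + α) * h2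
    - (-1) ^ k * 2 * (2 * (k : ℝ) + 1 + α) * (2 * k + α) * hq

/-! ### Explicit bounds for the moments -/

theorem absMoment_le_of_nonneg (α L : ℝ) (hα : 0 ≤ α) (N n : ℕ) :
    absMoment α L N n ≤
      2 * gammaFactor α n / (Real.Gamma (2 * α + 1) * Real.Gamma (n + 1)) := by
  rw [← normSqRatio_eq_gammaFactor α hα, ← mul_one (normSqRatio α n)]
  exact absMoment_le_of_le α L (by linarith) N n
    fun x hx => abs_gegenbauer_eval_le_one α hα n hx

theorem absMoment_le_of_even (α L : ℝ) (hα : -(1 / 2) < α) (h0 : α < 0) (N : ℕ) {n : ℕ}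
    (hn : Even n) :
    absMoment α L N n ≤ |n + α| / |α| * |Ring.choose ((n : ℝ) / 2 + α - 1) (n / 2)| := by
  refine (absMoment_le_of_le α L hα N n fun x hx =>
    abs_gegenbauer_eval_le_of_even α hα h0.le hn hx).trans_eq ?_
  obtain ⟨k, rfl⟩ := hn.exists_two_nsmul
  have h := congrArg abs (normSqRatio_mul_eval_zero α hα h0.ne k)
  have hc : Ring.choose (((2 • k : ℕ) : ℝ) / 2 + α - 1) (2 • k / 2) = Ring.multichoose α k := by
    rw [Ring.multichoose_eq]
    congr 1
    · push_cast [smul_eq_mul]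
      ring
    · simp
  rw [hc, ← normSqRatio]
  simp only [abs_mul, abs_pow, abs_neg, abs_one, one_pow, one_mul,
    abs_of_pos (normSqRatio_pos α hα _)] at h
  rw [div_mul_eq_mul_div, eq_div_iff (abs_pos.2 h0.ne).ne']
  push_cast [smul_eq_mul]
  linear_combination h

theorem absMoment_le_of_odd (α L : ℝ) (hα : -(1 / 2) < α) (h0 : α < 0) (N : ℕ) {n : ℕ}
    (hn : Odd n) :
    absMoment α L N n ≤ 2 * |n + α| * Real.Gamma (((n : ℝ) + 1) / 2 + α) /
      (Real.Gamma (α + 1) * Real.Gamma (((n : ℝ) + 1) / 2) * Real.sqrt (n * (n + 2 * α))) := by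
  obtain ⟨k, rfl⟩ := hn
  refine (absMoment_le_of_le α L hα N (2 * k + 1) fun x hx =>
    abs_gegenbauer_eval_le_of_odd α hα h0.le (odd_two_mul_add_one k) hx).trans_eq ?_
  have h := congrArg abs (normSqRatio_mul_eval_zero_of_odd α hα h0.ne k)
  have hG : 0 < Real.Gamma (α + 1) := Real.Gamma_pos_of_pos (by linarith)
  have hG' : 0 < Real.Gamma (k + 1 + α) := Real.Gamma_pos_of_pos (cast_add_one_add_pos hα k)
  have hk : 0 < 2 * (k : ℝ) + 1 := by positivity
  simp only [abs_mul, abs_pow, abs_neg, abs_one, one_pow, one_mul, abs_div, abs_of_pos hk,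
    abs_of_pos (normSqRatio_pos α hα _), abs_of_pos hG, abs_of_pos hG', Nat.abs_cast,
    abs_two] at h
  rw [← normSqRatio]
  push_cast
  rw [show (2 * (k : ℝ) + 1 + 1) / 2 = k + 1 by ring, Real.Gamma_nat_eq_factorial, mul_div_assoc',
    h]
  field_simp

/-! ### Asymptotic bounds for the moments -/

/-- The ratio is governed by ∏ (2α+1+j), the denominator of Euler's sequence for Γ(2α+1), which
eventually exceeds half its limit. The 8 is this 2 times a crude 4. -/
theorem eventually_normSqRatio_le (α : ℝ) (hα : -(1 / 2) < α) :
    ∃ K : ℕ, ∀ n : ℕ, K ≤ n →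
      normSqRatio α n ≤ 8 / Real.Gamma (2 * α + 1) * (n : ℝ) ^ (2 * α) := by
  have hG : 0 < Real.Gamma (2 * α + 1) := Real.Gamma_pos_of_pos (by linarith)
  obtain ⟨K, hK⟩ := Filter.eventually_atTop.1
    ((Real.GammaSeq_tendsto_Gamma (2 * α + 1)).eventually_const_le (half_lt_self hG))
  refine ⟨K + 2, fun n hn => ?_⟩
  obtain ⟨n, rfl⟩ : ∃ k, n = k + 1 := ⟨n - 1, by omega⟩
  have hseq := hK n (by omega)
  have hn1 : (1 : ℝ) ≤ n := by exact_mod_cast (by omega : 1 ≤ n)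
  have hprod (N : ℕ) : normSqRatio α (N + 1) * ((N + 1 + 2 * α) * (N + 1).factorial) =
      2 * (N + 1 + α) * ∏ j ∈ Finset.range (N + 1), (2 * α + 1 + (j : ℝ)) := by
    induction N with
    | zero =>
      rw [zero_add, normSqRatio_one α hα]
      simp only [zero_add, Nat.factorial_one, Finset.prod_range_one, Nat.cast_zero, Nat.cast_one]
      ring
    | succ N ih =>
      have h := normSqRatio_succ α hα (N + 1)
      have h1 := (cast_add_one_add_pos hα N).ne'
      rw [Finset.prod_range_succ, Nat.factorial_succ]
      apply mul_left_cancel₀ h1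
      push_cast at h ⊢
      linear_combination ((N : ℝ) + 1 + 1 + 2 * α) * (N + 1).factorial * h
        + ((N : ℝ) + 1 + 1 + α) * (N + 1 + 1 + 2 * α) * ih
  have hP : 0 < ∏ j ∈ Finset.range (n + 1), (2 * α + 1 + (j : ℝ)) := by
    refine Finset.prod_pos fun j _ => ?_
    have := cast_add_one_add_two_mul_pos hα j
    linarith
  set P := ∏ j ∈ Finset.range (n + 1), (2 * α + 1 + (j : ℝ)) with hPdef
  have hd := cast_add_one_add_two_mul_pos hα n
  have hf : (0 : ℝ) < n.factorial := by positivity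
  have hPle : P ≤ 2 / Real.Gamma (2 * α + 1) * ((n + 1 : ℝ) ^ (2 * α) * (n + 1)) *
      n.factorial := by
    rw [Real.GammaSeq, ← hPdef, le_div_iff₀ hP] at hseq
    -- Monotonicity is applied to the exponent 2α + 1 > 0, since 2α may be negative.
    have hmono : (n : ℝ) ^ (2 * α + 1) ≤ (n + 1 : ℝ) ^ (2 * α) * (n + 1) := by
      rw [← Real.rpow_add_one (by positivity)]
      exact Real.rpow_le_rpow (by positivity) (by linarith) (by linarith)
    have h3 : Real.Gamma (2 * α + 1) / 2 * P ≤ (n + 1 : ℝ) ^ (2 * α) * (n + 1) * n.factorial :=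
      hseq.trans (mul_le_mul_of_nonneg_right hmono hf.le)
    calc P = 2 / Real.Gamma (2 * α + 1) * (Real.Gamma (2 * α + 1) / 2 * P) := by field_simp
      _ ≤ 2 / Real.Gamma (2 * α + 1) * ((n + 1 : ℝ) ^ (2 * α) * (n + 1) * n.factorial) := by
        gcongr
      _ = _ := by ring
  -- Equivalent to n + 1 + 3α ≥ 0, which holds because n ≥ 1; this is what the shift of K by 2
  -- secures.
  have h4 : 2 * ((n : ℝ) + 1 + α) ≤ 4 * (n + 1 + 2 * α) := by linarith
  refine le_of_mul_le_mul_right (a := (n + 1 + 2 * α) * ((n + 1).factorial : ℝ)) ?_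
    (by positivity)
  rw [hprod n, Nat.factorial_succ]
  push_cast
  calc _ ≤ 4 * (n + 1 + 2 * α) * (2 / Real.Gamma (2 * α + 1) *
        ((n + 1 : ℝ) ^ (2 * α) * (n + 1)) * n.factorial) :=
        mul_le_mul h4 hPle hP.le (by positivity)
    _ = _ := by ring

theorem eventually_absMoment_mul_le (α : ℝ) (hα : -(1 / 2) < α) :
    ∃ K : ℕ, ∀ (l τ : ℝ) (Nx Nt n m : ℕ), K ≤ n → K ≤ m → n ≤ Nx → m ≤ Nt →
      absMoment α l Nx n * absMoment α τ Nt m ≤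
        8 / Real.Gamma (2 * α + 1) * ((n : ℝ) * m) ^ α := by
  obtain ⟨K, hK⟩ := eventually_normSqRatio_le α hα
  have hG : 0 < Real.Gamma (2 * α + 1) := Real.Gamma_pos_of_pos (by linarith)
  have hC : 0 ≤ 8 / Real.Gamma (2 * α + 1) := by positivity
  have hS (L : ℝ) (N n : ℕ) (h1 : K ≤ n) (h2 : n ≤ N) :
      absMoment α L N n ≤ Real.sqrt (8 / Real.Gamma (2 * α + 1)) * (n : ℝ) ^ α := by
    refine (absMoment_le_sqrt α L hα h2).trans ((Real.sqrt_le_sqrt (hK n h1)).trans_eq ?_)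
    rw [Real.sqrt_mul hC, mul_comm 2 α, Real.rpow_mul (Nat.cast_nonneg n), Real.rpow_two,
      Real.sqrt_sq (by positivity)]
  refine ⟨K, fun l τ Nx Nt n m hn hm hNx hNt => ?_⟩
  refine (mul_le_mul (hS l Nx n hn hNx) (hS τ Nt m hm hNt) (absMoment_nonneg α τ hα Nt m)
    (by positivity)).trans_eq ?_
  rw [Real.mul_rpow (Nat.cast_nonneg n) (Nat.cast_nonneg m)]
  linear_combination (n : ℝ) ^ α * (m : ℝ) ^ α * Real.mul_self_sqrt hC

theorem asymptoticConst_pos (α : ℝ) (hα : -(1 / 2) < α) : 0 < asymptoticConst α := by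
  have h1 : 0 < Real.Gamma (α + 1 / 2) := Real.Gamma_pos_of_pos (by linarith)
  have h2 : 0 < Real.Gamma (α + 1) := Real.Gamma_pos_of_pos (by linarith)
  have := Real.pi_pos
  unfold asymptoticConst
  positivity

/-- For α = 0 no power of n absorbs a constant: λ_0/λ_n = 2 for n ≥ 1, so the product of two moments
is at most 2, to be compared with 8π/e². -/
theorem two_le_asymptoticConst_zero : 2 ≤ asymptoticConst 0 := by
  have hπ := Real.pi_gt_three
  have h1 : asymptoticConst 0 = 8 * Real.pi / Real.exp 1 ^ 2 := by
    rw [asymptoticConst, zero_add, zero_add, Real.Gamma_one, Real.Gamma_one_half_eq,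
      Real.sq_sqrt Real.pi_pos.le]
    rw [show (-4 * (0 : ℝ) - 2) = -(1 + 1) by norm_num, Real.exp_neg, Real.exp_add]
    norm_num
    field_simp
    rw [← Real.exp_nat_mul]
    norm_num
  have h2 := Real.exp_one_lt_d9
  have h3 := Real.exp_pos 1
  rw [h1, le_div_iff₀ (by positivity)]
  nlinarith

theorem eventually_absMoment_mul_le_of_nonneg (α : ℝ) (hα : 0 ≤ α) :
    ∃ K : ℕ, ∀ (l τ : ℝ) (Nx Nt n m : ℕ), K ≤ n → K ≤ m → n ≤ Nx → m ≤ Nt →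
      absMoment α l Nx n * absMoment α τ Nt m ≤
        asymptoticConst α * ((n : ℝ) * m) ^ (2 * α) := by
  have hα' : -(1 / 2) < α := by linarith
  rcases hα.eq_or_lt with rfl | hpos
  · have hS (L : ℝ) (N n : ℕ) (h1 : 1 ≤ n) (h2 : n ≤ N) :
        absMoment 0 L N n ≤ Real.sqrt 2 := by
      refine (absMoment_le_sqrt 0 L hα' h2).trans_eq (congrArg Real.sqrt ?_)
      obtain ⟨k, rfl⟩ : ∃ k, n = k + 1 := ⟨n - 1, by omega⟩
      have h := normSqRatio_mul_Gamma 0 hα' k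
      have hf : (0 : ℝ) < k.factorial := by positivity
      have hk : (k : ℝ) + 1 ≠ 0 := by positivity
      simp only [mul_zero, zero_add, add_zero, Real.Gamma_one, one_mul,
        Real.Gamma_nat_eq_factorial, Nat.factorial_succ] at h
      push_cast at h
      rw [← normSqRatio]
      apply mul_right_cancel₀ (mul_ne_zero hk hf.ne')
      linear_combination h
    refine ⟨1, fun l τ Nx Nt n m hn hm hNx hNt => ?_⟩
    calc _ ≤ Real.sqrt 2 * Real.sqrt 2 := mul_le_mul (hS l Nx n hn hNx) (hS τ Nt m hm hNt)
          (absMoment_nonneg 0 τ hα' Nt m) (by positivity)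
      _ ≤ _ := by simpa using two_le_asymptoticConst_zero
  · obtain ⟨K, hK⟩ := eventually_absMoment_mul_le α hα'
    have hD := asymptoticConst_pos α hα'
    -- For α > 0, n^α eventually exceeds the ratio of the available constant to D₁, and m^α ≥ 1.
    obtain ⟨K', hK'⟩ := Filter.eventually_atTop.1
      (((tendsto_rpow_atTop hpos).comp tendsto_natCast_atTop_atTop).eventually_ge_atTop
        (8 / Real.Gamma (2 * α + 1) / asymptoticConst α))
    refine ⟨max K (max K' 1), fun l τ Nx Nt n m hn hm hNx hNt => ?_⟩
    simp only [max_le_iff] at hn hm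
    refine (hK l τ Nx Nt n m hn.1 hm.1 hNx hNt).trans ?_
    have h1 : 8 / Real.Gamma (2 * α + 1) ≤ asymptoticConst α * (n : ℝ) ^ α := by
      rw [← div_le_iff₀' hD]
      exact hK' n hn.2.1
    have h2 : 1 ≤ (m : ℝ) ^ α := Real.one_le_rpow (by exact_mod_cast hm.2.2) hpos.le
    have h3 : 0 ≤ (n : ℝ) ^ α := by positivity
    have hnm : (0 : ℝ) < n * m := by exact_mod_cast Nat.mul_pos hn.2.2 hm.2.2
    have h4 : ((n : ℝ) * m) ^ (2 * α) = ((n : ℝ) * m) ^ α * ((n : ℝ) * m) ^ α := by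
      rw [two_mul, Real.rpow_add hnm]
    rw [h4, ← mul_assoc]
    refine mul_le_mul_of_nonneg_right (h1.trans ?_) (by positivity)
    rw [Real.mul_rpow (Nat.cast_nonneg n) (Nat.cast_nonneg m)]
    nlinarith [mul_nonneg hD.le h3]

/-! ### Assembly -/

theorem IsTelegraphSolution.abs_discreteCoeff_le {α l τ β₁ β₂ : ℝ} {f : ℝ × ℝ → ℝ}
    {g₁ g₂ h₁ h₂ : ℝ → ℝ} {u : ℝ × ℝ → ℝ} (hα : -(1 / 2) < α) (hl : 0 < l) (hτ : 0 < τ)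
    (hu : IsTelegraphSolution l τ β₁ β₂ f g₁ g₂ h₁ h₂ u) (Nx Nt n m : ℕ) {a b : ℝ}
    (ha : absMoment α l Nx n ≤ a) (hb : absMoment α τ Nt m ≤ b) :
    |discreteCoeff α l τ Nx Nt (partialXX l u) n m| ≤
      a * b * linftyNorm l τ (partialXX l u) := by
  refine (_root_.abs_discreteCoeff_le α hα hl hτ Nx Nt (fun x hx t ht =>
    abs_le_linftyNorm (continuousOn_partialXX hl hτ hu.contDiffOn) hx ht) n m).trans ?_
  have h0 := absMoment_nonneg α l hα Nx n
  have h1 := absMoment_nonneg α τ hα Nt m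
  exact mul_le_mul_of_nonneg_right (mul_le_mul ha hb h1 (h0.trans ha)) ENNReal.toReal_nonneg

theorem mainTheorem6 (α : ℝ) (hα : -(1 / 2) < α) :
    (∀ (l τ β₁ β₂ : ℝ) (f : ℝ × ℝ → ℝ) (g₁ g₂ h₁ h₂ : ℝ → ℝ) (u : ℝ × ℝ → ℝ),
      0 < l → 0 < τ → IsTelegraphSolution l τ β₁ β₂ f g₁ g₂ h₁ h₂ u →
      ∀ Nx Nt n m : ℕ, n ≤ Nx → m ≤ Nt →
        (0 ≤ α →
          |discreteCoeff α l τ Nx Nt (partialXX l u) n m| ≤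
            4 * gammaFactor α n * gammaFactor α m /
              (Real.Gamma (2 * α + 1) ^ 2 * Real.Gamma (n + 1) * Real.Gamma (m + 1)) *
              linftyNorm l τ (partialXX l u)) ∧
        (α < 0 → Even n → Even m →
          |discreteCoeff α l τ Nx Nt (partialXX l u) n m| ≤
            |(n + α) * (m + α)| / α ^ 2 *
              |Ring.choose ((n : ℝ) / 2 + α - 1) (n / 2) *
                Ring.choose ((m : ℝ) / 2 + α - 1) (m / 2)| *
              linftyNorm l τ (partialXX l u)) ∧
        (α < 0 → Odd n → Odd m →
          |discreteCoeff α l τ Nx Nt (partialXX l u) n m| ≤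
            4 * |(n + α) * (m + α)| *
                Real.Gamma (((n : ℝ) + 1) / 2 + α) * Real.Gamma (((m : ℝ) + 1) / 2 + α) /
              (Real.Gamma (α + 1) ^ 2 *
                Real.Gamma (((n : ℝ) + 1) / 2) * Real.Gamma (((m : ℝ) + 1) / 2) *
                ((n : ℝ) ^ 2 * (m : ℝ) ^ 2 * (n + 2 * α) ^ 2 * (m + 2 * α) ^ 2)
                  ^ (1 / 4 : ℝ)) *
              linftyNorm l τ (partialXX l u)) ∧
        (α < 0 → Even n → Odd m →
          |discreteCoeff α l τ Nx Nt (partialXX l u) n m| ≤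
            2 * Real.Gamma (((m : ℝ) + 1) / 2 + α) * |(n + α) * (m + α)| /
              (α ^ 2 * Real.sqrt (m * (m + 2 * α)) *
                Real.Gamma (((m : ℝ) + 1) / 2) * |Real.Gamma α|) *
              |Ring.choose ((n : ℝ) / 2 + α - 1) (n / 2)| *
              linftyNorm l τ (partialXX l u)) ∧
        (α < 0 → Odd n → Even m →
          |discreteCoeff α l τ Nx Nt (partialXX l u) n m| ≤
            2 * Real.Gamma (((n : ℝ) + 1) / 2 + α) * |(n + α) * (m + α)| /
              (α ^ 2 * Real.sqrt (n * (n + 2 * α)) *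
                Real.Gamma (((n : ℝ) + 1) / 2) * |Real.Gamma α|) *
              |Ring.choose ((m : ℝ) / 2 + α - 1) (m / 2)| *
              linftyNorm l τ (partialXX l u))) ∧
    (0 ≤ α →
      ∃ K : ℕ,
        ∀ (l τ β₁ β₂ : ℝ) (f : ℝ × ℝ → ℝ) (g₁ g₂ h₁ h₂ : ℝ → ℝ) (u : ℝ × ℝ → ℝ),
          0 < l → 0 < τ → IsTelegraphSolution l τ β₁ β₂ f g₁ g₂ h₁ h₂ u →
          ∀ Nx Nt n m : ℕ, K ≤ n → K ≤ m → n ≤ Nx → m ≤ Nt →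
            |discreteCoeff α l τ Nx Nt (partialXX l u) n m| ≤
              asymptoticConst α * ((n : ℝ) * m) ^ (2 * α) *
                linftyNorm l τ (partialXX l u)) ∧
    (α < 0 →
      ∃ A₁ A₂ : ℝ, 1 < A₁ ∧ 1 < A₂ ∧ ∃ K : ℕ,
        ∀ (l τ β₁ β₂ : ℝ) (f : ℝ × ℝ → ℝ) (g₁ g₂ h₁ h₂ : ℝ → ℝ) (u : ℝ × ℝ → ℝ),
          0 < l → 0 < τ → IsTelegraphSolution l τ β₁ β₂ f g₁ g₂ h₁ h₂ u →
          ∀ Nx Nt n m : ℕ, K ≤ n → K ≤ m → n ≤ Nx → m ≤ Nt →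
            |discreteCoeff α l τ Nx Nt (partialXX l u) n m| ≤
              A₁ * A₂ * asymptoticConst α * ((n : ℝ) * m) ^ α *
                linftyNorm l τ (partialXX l u)) := by
  refine ⟨?_, fun h0 => ?_, fun h0 => ?_⟩
  · intro l τ β₁ β₂ f g₁ g₂ h₁ h₂ u hl hτ hu Nx Nt n m _ _
    -- In mixed parity, 1/|α| from the even factor and 1/Γ(α+1) from the odd one merge into 1/(α²
    -- |Γ(α)|).
    have hΓabs (h : α < 0) : |α| * |Real.Gamma α| = Real.Gamma (α + 1) := by
      rw [← abs_mul, ← Real.Gamma_add_one h.ne,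
        abs_of_pos (Real.Gamma_pos_of_pos (by linarith : 0 < α + 1))]
    have hmixed (h : α < 0) (k : ℕ) (G G' s c y : ℝ) :
        |(k : ℝ) + α| / |α| * c * (2 * y * G / (Real.Gamma (α + 1) * G' * s)) =
          2 * G * (|k + α| * y) / (α ^ 2 * s * G' * |Real.Gamma α|) * c := by
      rw [← hΓabs h, ← sq_abs α]
      ring
    refine ⟨fun h0 => ?_, fun h0 hn hm => ?_, fun h0 hn hm => ?_, fun h0 hn hm => ?_,
      fun h0 hn hm => ?_⟩
    · refine (hu.abs_discreteCoeff_le hα hl hτ Nx Nt n m (absMoment_le_of_nonneg α l h0 Nx n)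
        (absMoment_le_of_nonneg α τ h0 Nt m)).trans_eq ?_
      ring
    · refine (hu.abs_discreteCoeff_le hα hl hτ Nx Nt n m (absMoment_le_of_even α l hα h0 Nx hn)
        (absMoment_le_of_even α τ hα h0 Nt hm)).trans_eq ?_
      rw [abs_mul, abs_mul, ← sq_abs α]
      ring
    · refine (hu.abs_discreteCoeff_le hα hl hτ Nx Nt n m (absMoment_le_of_odd α l hα h0 Nx hn)
        (absMoment_le_of_odd α τ hα h0 Nt hm)).trans_eq ?_
      have hpos {k : ℕ} (hk : Odd k) : 0 ≤ (k : ℝ) * (k + 2 * α) := by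
        have : (1 : ℝ) ≤ k := by exact_mod_cast hk.pos
        exact mul_nonneg (by linarith) (by linarith)
      have hroot : ((n : ℝ) ^ 2 * (m : ℝ) ^ 2 * (n + 2 * α) ^ 2 * (m + 2 * α) ^ 2) ^ (1 / 4 : ℝ) =
          Real.sqrt (n * (n + 2 * α)) * Real.sqrt (m * (m + 2 * α)) := by
        rw [← Real.sqrt_mul (hpos hn), Real.sqrt_eq_rpow,
          show (n : ℝ) ^ 2 * (m : ℝ) ^ 2 * (n + 2 * α) ^ 2 * (m + 2 * α) ^ 2 =
            (n * (n + 2 * α) * (m * (m + 2 * α))) ^ (2 : ℝ) by rw [Real.rpow_two]; ring,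
          ← Real.rpow_mul (mul_nonneg (hpos hn) (hpos hm))]
        norm_num
      rw [abs_mul, hroot]
      ring
    · refine (hu.abs_discreteCoeff_le hα hl hτ Nx Nt n m (absMoment_le_of_even α l hα h0 Nx hn)
        (absMoment_le_of_odd α τ hα h0 Nt hm)).trans_eq ?_
      rw [hmixed h0, abs_mul]
    · refine (hu.abs_discreteCoeff_le hα hl hτ Nx Nt n m (absMoment_le_of_odd α l hα h0 Nx hn)
        (absMoment_le_of_even α τ hα h0 Nt hm)).trans_eq ?_
      rw [mul_comm (2 * _ * _ / _), hmixed h0, abs_mul]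
      ring
  · obtain ⟨K, hK⟩ := eventually_absMoment_mul_le_of_nonneg α h0
    refine ⟨K, fun l τ β₁ β₂ f g₁ g₂ h₁ h₂ u hl hτ hu Nx Nt n m hn hm hNx hNt => ?_⟩
    exact (hu.abs_discreteCoeff_le hα hl hτ Nx Nt n m le_rfl le_rfl).trans
      (mul_le_mul_of_nonneg_right (hK l τ Nx Nt n m hn hm hNx hNt) ENNReal.toReal_nonneg)
  · obtain ⟨K, hK⟩ := eventually_absMoment_mul_le α hα
    have hD := asymptoticConst_pos α hα
    have hG : 0 < Real.Gamma (2 * α + 1) := Real.Gamma_pos_of_pos (by linarith)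
    set C := 8 / Real.Gamma (2 * α + 1) with hC
    have hCpos : 0 < C := by positivity
    have hA : 1 < 2 + C / asymptoticConst α := by
      have : 0 < C / asymptoticConst α := by positivity
      linarith
    -- The summand C/D₁ makes A₁ D₁ dominate C; the added 2 and A₂ = 2 only ensure that both exceed
    -- 1.
    refine ⟨2 + C / asymptoticConst α, 2, hA, one_lt_two, K,
      fun l τ β₁ β₂ f g₁ g₂ h₁ h₂ u hl hτ hu Nx Nt n m hn hm hNx hNt => ?_⟩
    refine (hu.abs_discreteCoeff_le hα hl hτ Nx Nt n m le_rfl le_rfl).trans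
      (mul_le_mul_of_nonneg_right ((hK l τ Nx Nt n m hn hm hNx hNt).trans ?_)
        ENNReal.toReal_nonneg)
    refine mul_le_mul_of_nonneg_right ?_ (by positivity)
    have h1 : C / asymptoticConst α * asymptoticConst α = C := div_mul_cancel₀ _ hD.ne'
    nlinarith
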